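/- An instance of $1\,|\,\alpha(t_i),\,G=\text{2-stage bipartite}\,|\,C_{\max}$ consists of finitely many stretched coupled-tasks with stretch factors $\alpha(t)\in\mathbb N$, partitioned into $V_0,V_1,V_2$, and an oriented compatibility graph $G=(V_0\cup V_1\cup V_2,E_1\cup E_2)$, in which every arc goes from $V_0$ to $V_1$ or from $V_1$ to $V_2$ and from a task of smaller to a task of strictly larger stretch factor. A task $t$ started at time $s\ge 0$ occupies the single machine during $[s,s+\alpha(t))$ and $[s+2\alpha(t),s+3\alpha(t))$, and is idle in between. In a feasible schedule no two sub-tasks of different tasks overlap, and two tasks that are not joined by an arc are executed one after the other (the intervals $[s,s+3\alpha(t))$ are disjoint). The makespan $C_{\max}$ is the latest completion time, and $OPT$ is its minimum over all feasible schedules. Write $seq(X)=\sum_{t\in X}3\alpha(t)$. A task $x$ is packed into $y$ if $(x,y)$ is an arc and $x$ is entirely executed during the idle time of $y$. For $i\in\{0,1\}$, the MKAR (multiple knapsack with assignment restrictions) instance of the stage $G[V_i\cup V_{i+1}]$ has the tasks $x\in V_i$ as items with weight and profit $3\alpha(x)$, the tasks $y\in V_{i+1}$ as bins of capacity $\alpha(y)$,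 and $x$ may be put into $y$ only if $(x,y)$ is an arc. **Theorem.** There is an algorithm that runs in time polynomial in the binary length of the instance (on a random access machine with logarithmic cost) and computes for every instance a feasible schedule $S$ with integer starting times such that: 1. there are packings $P_0,P_1$ of the MKAR instances of the stages $G[V_0\cup V_1]$ and $G[V_1\cup V_2]$, each with at least half of the maximum profit, such that $S$ results from them by resolving conflicts in favour of the second stage: $x$ is packed into $y$ in $S$ if and only if $P_1$ puts $x$ into $y$, or $P_0$ puts $x$ into $y$ and $P_1$ does not put $y$ into any bin; and $C_{\max}(S)=seq(\{x : x \text{ is not packed in } S\})$; 2. $C_{\max}(S)\le \frac{13}{9}\,OPT$; 3. $C_{\max}(S)\le OPT+\frac56\,seq(V_{1,p}^*)+\frac12\,seq(V_{0,p}^*)$, where $V_{i,p}^*$ is the set of tasks of $V_i$ that are packed in an optimal schedule; more generally, $C_{\max}(S)\le C_{\max}(T)+\frac56\,seq(V_{1,p}(T))+\frac12\,seq(V_{0,p}(T))$ for every feasible schedule $T$, where $V_{i,p}(T)$ is the set of tasks of $V_i$ packed in $T$; 4. $C_{\max}(S)\le OPT+\frac56\,seq(V_{1,p}^*[G_1])+\frac12\,seq(V_{0,p}^*[G_0])$,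 where $V_{1,p}^*[G_1]$ (respectively $V_{0,p}^*[G_0]$) is the set of tasks of $V_1$ (respectively $V_0$) packed in an arbitrary optimal schedule of the tasks of $G_1=G[V_1\cup V_2]$ alone (respectively $G_0=G[V_0\cup V_1]$ alone). -/

import Mathlib

open Finset
open scoped NNReal

/-! ### Random access machines with logarithmic cost

A program works on finitely many arrays of natural numbers (array names are constants of the
program, indices are computed).  It is built from arithmetic expressions, assignments, sequencing,
conditionals and loops.  Following the logarithmic cost criterion, every elementary operation costs
one plus the binary lengths of all the numbers (indices included) that take part in it. -/

namespace RAM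

/-- Memory contents: `m a i` is the content of cell `i` of array `a`. -/
abbrev Mem := ℕ → ℕ → ℕ

inductive Expr : Type
  | lit (k : ℕ)
  | get (a : ℕ) (idx : Expr)
  | add (e f : Expr)
  | sub (e f : Expr)
  | mul (e f : Expr)
  | div (e f : Expr)

/-- Value of an expression (`sub` is truncated, `div` rounds down, `x / 0 = 0`). -/
def Expr.eval (m : Mem) : Expr → ℕ
  | .lit k => k
  | .get a idx => m a (idx.eval m)
  | .add e f => e.eval m + f.eval m
  | .sub e f => e.eval m - f.eval m
  | .mul e f => e.eval m * f.eval m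
  | .div e f => e.eval m / f.eval m

/-- Logarithmic cost of evaluating an expression; `Nat.size` is the binary length. -/
def Expr.cost (m : Mem) : Expr → ℕ
  | .lit k => 1 + k.size
  | .get a idx => idx.cost m + (1 + (idx.eval m).size + (m a (idx.eval m)).size)
  | .add e f => e.cost m + f.cost m +
      (1 + (e.eval m).size + (f.eval m).size + (e.eval m + f.eval m).size)
  | .sub e f => e.cost m + f.cost m +
      (1 + (e.eval m).size + (f.eval m).size + (e.eval m - f.eval m).size)
  | .mul e f => e.cost m + f.cost m +
      (1 + (e.eval m).size + (f.eval m).size + (e.eval m * f.eval m).size)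
  | .div e f => e.cost m + f.cost m +
      (1 + (e.eval m).size + (f.eval m).size + (e.eval m / f.eval m).size)

/-- Programs.  `set a idx e` is the assignment `a[idx] := e`; `cond e c d` runs `c` if `e` is
nonzero and `d` otherwise; `loop e c` repeats `c` as long as `e` is nonzero. -/
inductive Prog : Type
  | skip
  | set (a : ℕ) (idx e : Expr)
  | seq (c d : Prog)
  | cond (e : Expr) (c d : Prog)
  | loop (e : Expr) (c : Prog)

/-- The memory after writing `x` into cell `i` of array `a`. -/
def Mem.write (m : Mem) (a i x : ℕ) : Mem :=
  fun b j => if b = a ∧ j = i then x else m b j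

/-- `Exec c m m' t`: started in memory `m`, the program `c` halts in memory `m'`, and the total
cost of the execution is `t`. -/
inductive Exec : Prog → Mem → Mem → ℕ → Prop
  | skip (m : Mem) : Exec .skip m m 1
  | set (a : ℕ) (idx e : Expr) (m : Mem) :
      Exec (.set a idx e) m (m.write a (idx.eval m) (e.eval m))
        (idx.cost m + e.cost m + (1 + (idx.eval m).size + (e.eval m).size))
  | seq {c d : Prog} {m m₁ m₂ : Mem} {t₁ t₂ : ℕ} :
      Exec c m m₁ t₁ → Exec d m₁ m₂ t₂ → Exec (.seq c d) m m₂ (t₁ + t₂)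
  | cond_true {e : Expr} {c d : Prog} {m m₁ : Mem} {t : ℕ} :
      e.eval m ≠ 0 → Exec c m m₁ t → Exec (.cond e c d) m m₁ (e.cost m + 1 + t)
  | cond_false {e : Expr} {c d : Prog} {m m₁ : Mem} {t : ℕ} :
      e.eval m = 0 → Exec d m m₁ t → Exec (.cond e c d) m m₁ (e.cost m + 1 + t)
  | loop_true {e : Expr} {c : Prog} {m m₁ m₂ : Mem} {t₁ t₂ : ℕ} :
      e.eval m ≠ 0 → Exec c m m₁ t₁ → Exec (.loop e c) m₁ m₂ t₂ →
      Exec (.loop e c) m m₂ (e.cost m + 1 + t₁ + t₂)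
  | loop_false {e : Expr} {c : Prog} {m : Mem} :
      e.eval m = 0 → Exec (.loop e c) m m (e.cost m + 1)

/-- Initial memory on input `L`: array `0` holds the entries of `L`, cell `0` of array `1` holds
the length of `L`, and every other cell is `0`. -/
def load (L : List ℕ) : Mem
  | 0, i => L.getD i 0
  | 1, 0 => L.length
  | _, _ => 0

/-- The list `L` is the output read off from memory `m` (same convention as for the input). -/
def Holds (m : Mem) (L : List ℕ) : Prop :=
  m 1 0 = L.length ∧ ∀ i < L.length, m 0 i = L.getD i 0

/-- Size of an input: the total binary length of its entries, plus one separator per entry. -/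
def bitLength (L : List ℕ) : ℕ := (L.map fun x => x.size + 1).sum

/-- Some program, started on the encoding `enc x` of an arbitrary `x`, halts with output `out x`
after a running time that is polynomial in the binary length of `enc x`. -/
def PolyTimeComputable {ι : Type} (enc out : ι → List ℕ) : Prop :=
  ∃ (c : Prog) (p : Polynomial ℕ), ∀ x : ι, ∃ (m : Mem) (t : ℕ),
    Exec c (load (enc x)) m t ∧ Holds m (out x) ∧ t ≤ p.eval (bitLength (enc x))

end RAM

/-! ### Stretched coupled-tasks with a 2-stage bipartite compatibility graph -/

/-- An instance: tasks `0, …, n - 1`, each lying in one of the layers `V₀, V₁, V₂` (`layer`), with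
stretch factors `α`, and the oriented compatibility graph `arc`.  Every arc goes from `V₀` to `V₁`
or from `V₁` to `V₂`; arcs are oriented from the smaller stretch factor to the larger one. -/
structure TwoStage where
  n : ℕ
  layer : Fin n → Fin 3
  α : Fin n → ℕ
  arc : Fin n → Fin n → Bool
  arc_layer : ∀ u v, arc u v = true → (layer v : ℕ) = (layer u : ℕ) + 1
  arc_lt : ∀ u v, arc u v = true → α u < α v

namespace TwoStage

/-- The input of an algorithm: the number of tasks, the layers, the stretch factors, and the
adjacency matrix row by row. -/
def encode (I : TwoStage) : List ℕ :=
  I.n :: (List.ofFn fun u => (I.layer u : ℕ)) ++ List.ofFn I.α ++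
    (List.finRange I.n).flatMap fun u => List.ofFn fun v => (I.arc u v).toNat

variable (I : TwoStage)

/-- Two tasks are compatible if they are joined by an arc. -/
def Compatible (u v : Fin I.n) : Prop := I.arc u v = true ∨ I.arc v u = true

/-- `V i` is the set of tasks of layer `i`. -/
def V (i : Fin 3) : Finset (Fin I.n) := univ.filter fun u => I.layer u = i

/-- Time needed to execute the tasks of `X` one after the other. -/
def seq (X : Finset (Fin I.n)) : ℕ := ∑ u ∈ X, 3 * I.α u

/-- A schedule gives the (real, nonnegative) starting time of every task. -/
abbrev Schedule := Fin I.n → ℝ≥0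

variable {I}

/-- Execution of the first sub-task of `u`, of length `α u`. -/
def first (σ : I.Schedule) (u : Fin I.n) : Set ℝ≥0 := Set.Ico (σ u) (σ u + I.α u)

/-- Execution of the second sub-task of `u`, which starts exactly `α u` time units after the end
of the first one and has length `α u` again. -/
def second (σ : I.Schedule) (u : Fin I.n) : Set ℝ≥0 :=
  Set.Ico (σ u + 2 * I.α u) (σ u + 3 * I.α u)

/-- The interval from the start of the first sub-task of `u` to the end of its second one. -/
def window (σ : I.Schedule) (u : Fin I.n) : Set ℝ≥0 := Set.Ico (σ u) (σ u + 3 * I.α u)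

/-- `σ` is a valid one-machine schedule of the tasks of `A`: sub-tasks of different tasks do not
overlap, and tasks that are not compatible are executed one after the other. -/
def Feasible (A : Finset (Fin I.n)) (σ : I.Schedule) : Prop :=
  ∀ u ∈ A, ∀ v ∈ A, u ≠ v →
    Disjoint (first σ u ∪ second σ u) (first σ v ∪ second σ v) ∧
    (¬ I.Compatible u v → Disjoint (window σ u) (window σ v))

/-- The completion time of the last task of `A` (`0` if `A` is empty). -/
noncomputable def makespan (A : Finset (Fin I.n)) (σ : I.Schedule) : ℝ≥0 :=
  A.sup fun u => σ u + 3 * I.α u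

/-- `σ` is an optimal schedule of the tasks of `A`. -/
def IsOptimal (A : Finset (Fin I.n)) (σ : I.Schedule) : Prop :=
  Feasible A σ ∧ ∀ τ : I.Schedule, Feasible A τ → makespan A σ ≤ makespan A τ

/-- In `σ`, the task `u` is packed into the task `v`: there is an arc from `u` to `v`, and `u` is
entirely executed during the idle time of `v`. -/
def PackedInto (σ : I.Schedule) (u v : Fin I.n) : Prop :=
  I.arc u v = true ∧ σ v + I.α v ≤ σ u ∧ σ u + 3 * I.α u ≤ σ v + 2 * I.α v

open Classical in
/-- The tasks of `Vᵢ` that are packed into some task in the schedule `σ` of the tasks of `A`. -/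
noncomputable def packed (A : Finset (Fin I.n)) (σ : I.Schedule) (i : Fin 3) :
    Finset (Fin I.n) :=
  A.filter fun u => I.layer u = i ∧ ∃ v ∈ A, PackedInto σ u v

/-- Multiple knapsack with assignment restrictions for the arcs that leave `Vᵢ`: every task `u`
of `Vᵢ` is an item of weight and profit `3 α u`, every task `v` of `Vᵢ₊₁` is a bin of capacity
`α v`, and `u` may be put into `v` only along an arc.  `P u = some v` says that `u` is put into
`v`, and `P u = none` that `u` is not put into any bin. -/
def IsPacking (i : Fin 3) (P : Fin I.n → Option (Fin I.n)) : Prop :=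
  (∀ u v, P u = some v → I.layer u = i ∧ I.arc u v = true) ∧
  ∀ v, I.seq (univ.filter fun u => P u = some v) ≤ I.α v

/-- The total profit of the items put into bins. -/
def profit (P : Fin I.n → Option (Fin I.n)) : ℕ := I.seq (univ.filter fun u => P u ≠ none)

/-- `P` is a packing whose profit is at least half of the maximum. -/
def IsHalfApprox (i : Fin 3) (P : Fin I.n → Option (Fin I.n)) : Prop :=
  IsPacking i P ∧
    ∀ Q : Fin I.n → Option (Fin I.n), IsPacking i Q → (1 / 2 : ℝ≥0) * profit Q ≤ profit P

open Classical in
/-- `σ` is the schedule obtained from a packing `P₀` of `V₀` into `V₁` and a packing `P₁` of `V₁`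
into `V₂` by resolving conflicts in favour of `P₁`: the tasks packed by `P₁` stay packed, a task
`u` packed by `P₀` into `v` stays packed unless `P₁` packs `v`, nothing else is packed, and all
the tasks that are not packed are executed one after the other without any interruption. -/
def IsMerge (P₀ P₁ : Fin I.n → Option (Fin I.n)) (σ : I.Schedule) : Prop :=
  (∀ u v, PackedInto σ u v ↔ P₁ u = some v ∨ (P₀ u = some v ∧ P₁ v = none)) ∧
  makespan univ σ = I.seq (univ.filter fun u => ¬ ∃ v, PackedInto σ u v)

end TwoStage

/-! Both stages are treated as a single packing problem in which every task is at once an item of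
weight `3α` and a bin of capacity `α`; layers enter only the analysis, through `stage`.

The factor one half comes from overfull assignments. Suppose every assigned item fits alone into its
bin, and every bin respects its capacity after the deletion of a suitable item. Keeping in an
overfull bin the heavier of that item and the rest yields a packing with at least half of the
assigned weight (`half_of_kept`). It remains to find such an assignment that is at least as heavy as
every packing, and push-relabel does so. Call a bin active if it stays overfull whichever item is
deleted. Items of active bins are pushed to eligible bins of smaller label; if no push is possible,
an active bin is relabelled, or loses an item once its label is `n + 2`. Throughout, labels drop by
at most one from the bin of an item to any bin eligible for it, items left outside see only labels
of at least `n + 1`, and bins of positive label are full. As there are only `n` bins, some `k` in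
`1, …, n + 1` is not a label (`exists_gap`). Bins above `k` are full, hence hold as much as any
packing `Q` puts there; items that `Q` puts below `k` are assigned, and not to bins above `k`. Hence
the assignment is at least as heavy as `Q` (`Certificate.profit_le_overfull`).

Merging produces a forest of depth one; its schedule runs the unpacked tasks one after another, with
the packed ones inside their idle times (`IsForest.makespan_eq`). A bin that the second stage packs
holds at most a third of its own profit, so merging loses at most a third of the second-stage profit
(`IsMultiPacking.seq_roots_le`). An arbitrary feasible schedule lasts at least as long as its
unpacked tasks together, and its packed tasks form packings of the two stages. With `pᵢ` the weight
it packs in stage `i`, the excess over it is at most `2/3 p₁ + 1/2 p₀` (`makespan_merge_le`), which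
is stronger than the additive bound claimed. Packed tasks of positive length have unpacked hosts, so
`p₀ + p₁` is at most a third of the makespan (`Feasible.seq_packed_le`), and the multiplicative
bound follows. A single stage has no conflicts, so its optimal schedules pack the maximum profit
(`IsOptimal.profit_le`).

For the running time, a program without multiplication lengthens numbers by boundedly many bits per
step, so a polynomial number of unit-cost steps suffices (`Run.exec`); a cubic potential bounds the
number of push-relabel sweeps. -/

namespace RAM

/-! ### Unit-cost runs and their logarithmic cost -/

/-- `Run c m m' k`: started in `m`, the program `c` halts in `m'` after `k` elementary steps. -/
inductive Run : Prog → Mem → Mem → ℕ → Prop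
  | skip (m : Mem) : Run .skip m m 1
  | set (a : ℕ) (idx e : Expr) (m : Mem) :
      Run (.set a idx e) m (m.write a (idx.eval m) (e.eval m)) 1
  | seq {c d : Prog} {m m₁ m₂ : Mem} {k₁ k₂ : ℕ} :
      Run c m m₁ k₁ → Run d m₁ m₂ k₂ → Run (.seq c d) m m₂ (k₁ + k₂)
  | cond_true {e : Expr} {c d : Prog} {m m₁ : Mem} {k : ℕ} :
      e.eval m ≠ 0 → Run c m m₁ k → Run (.cond e c d) m m₁ (1 + k)
  | cond_false {e : Expr} {c d : Prog} {m m₁ : Mem} {k : ℕ} :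
      e.eval m = 0 → Run d m m₁ k → Run (.cond e c d) m m₁ (1 + k)
  | loop_true {e : Expr} {c : Prog} {m m₁ m₂ : Mem} {k₁ k₂ : ℕ} :
      e.eval m ≠ 0 → Run c m m₁ k₁ → Run (.loop e c) m₁ m₂ k₂ →
      Run (.loop e c) m m₂ (1 + k₁ + k₂)
  | loop_false {e : Expr} {c : Prog} {m : Mem} :
      e.eval m = 0 → Run (.loop e c) m m 1

/-- Size of an expression. -/
def Expr.weight : Expr → ℕ
  | .lit k => k.size + 1
  | .get _ idx => idx.weight + 1
  | .add e f => e.weight + f.weight + 1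
  | .sub e f => e.weight + f.weight + 1
  | .mul e f => e.weight + f.weight + 1
  | .div e f => e.weight + f.weight + 1

/-- The expression contains no multiplication. -/
def Expr.MulFree : Expr → Prop
  | .lit _ => True
  | .get _ idx => idx.MulFree
  | .add e f => e.MulFree ∧ f.MulFree
  | .sub e f => e.MulFree ∧ f.MulFree
  | .mul _ _ => False
  | .div e f => e.MulFree ∧ f.MulFree

/-- No multiplication occurs in the program, and the size of all its expressions is at most `W`. -/
def Prog.Light (W : ℕ) : Prog → Prop
  | .skip => True
  | .set _ idx e => (idx.MulFree ∧ idx.weight ≤ W) ∧ e.MulFree ∧ e.weight ≤ W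
  | .seq c d => c.Light W ∧ d.Light W
  | .cond e c d => (e.MulFree ∧ e.weight ≤ W) ∧ c.Light W ∧ d.Light W
  | .loop e c => (e.MulFree ∧ e.weight ≤ W) ∧ c.Light W

/-- Largest size of an expression of a program. -/
def Prog.maxWeight : Prog → ℕ
  | .skip => 0
  | .set _ idx e => max idx.weight e.weight
  | .seq c d => max c.maxWeight d.maxWeight
  | .cond e c d => max e.weight (max c.maxWeight d.maxWeight)
  | .loop e c => max e.weight c.maxWeight

/-- No multiplication occurs in the program. -/
def Prog.MulFree : Prog → Prop
  | .skip => True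
  | .set _ idx e => idx.MulFree ∧ e.MulFree
  | .seq c d => c.MulFree ∧ d.MulFree
  | .cond e c d => e.MulFree ∧ c.MulFree ∧ d.MulFree
  | .loop e c => e.MulFree ∧ c.MulFree

theorem Prog.MulFree.light : ∀ {c : Prog} {W : ℕ}, c.MulFree → c.maxWeight ≤ W → c.Light W
  | .skip, _, _, _ => trivial
  | .set _ _ _, _, h, hW => by
      simp only [maxWeight, max_le_iff] at hW
      exact ⟨⟨h.1, hW.1⟩, h.2, hW.2⟩
  | .seq _ _, _, h, hW => by
      simp only [maxWeight, max_le_iff] at hW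
      exact ⟨h.1.light hW.1, h.2.light hW.2⟩
  | .cond _ _ _, _, h, hW => by
      simp only [maxWeight, max_le_iff] at hW
      exact ⟨⟨h.1, hW.1⟩, h.2.1.light hW.2.1, h.2.2.light hW.2.2⟩
  | .loop _ _, _, h, hW => by
      simp only [maxWeight, max_le_iff] at hW
      exact ⟨⟨h.1, hW.1⟩, h.2.light hW.2⟩

theorem size_add_le {x y s : ℕ} (hx : x.size ≤ s) (hy : y.size ≤ s) : (x + y).size ≤ s + 1 := by
  rw [Nat.size_le] at *
  rw [pow_succ]
  omega

/-- Only addition lengthens its operands, and by one bit. A product could double the length, which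
iterated would destroy the polynomial bound; hence `MulFree`. -/
theorem Expr.size_eval_le {m : Mem} {B : ℕ} (hm : ∀ a i, (m a i).size ≤ B) :
    ∀ e : Expr, e.MulFree → (e.eval m).size ≤ B + e.weight
  | .lit k, _ => by simp only [eval, weight]; omega
  | .get a idx, _ => (hm _ _).trans (Nat.le_add_right _ _)
  | .add e f, h => by
      have he := size_eval_le hm e h.1
      have hf := size_eval_le hm f h.2
      exact (size_add_le (s := B + e.weight + f.weight) (by omega) (by omega)).trans
        (by simp only [weight]; omega)
  | .sub e f, h => by
      have he := size_eval_le hm e h.1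
      exact (Nat.size_le_size (Nat.sub_le _ _)).trans (he.trans (by simp only [weight]; omega))
  | .mul e f, h => h.elim
  | .div e f, h => by
      have he := size_eval_le hm e h.1
      exact (Nat.size_le_size (Nat.div_le_self _ _)).trans
        (he.trans (by simp only [weight]; omega))

/-- All intermediate values have at most `D` bits and each operation involves at most three of them,
so it costs at most `3 * D + 1`. -/
theorem Expr.cost_le {m : Mem} {B D : ℕ} (hm : ∀ a i, (m a i).size ≤ B) :
    ∀ e : Expr, e.MulFree → B + e.weight ≤ D → e.cost m ≤ e.weight * (3 * D + 1)
  | .lit k, _, hD => by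
      simp only [cost, weight] at *
      nlinarith [Nat.zero_le (k.size * D)]
  | .get a idx, h, hD => by
      simp only [weight] at hD
      have h1 := cost_le (D := D) hm idx h (by omega)
      have h2 := size_eval_le hm idx h
      have h3 := hm a (idx.eval m)
      simp only [cost, weight, add_mul]
      omega
  | .add e f, h, hD => by
      have h3 := size_eval_le hm (.add e f) h
      simp only [weight, eval] at hD h3
      have h1 := cost_le (D := D) hm e h.1 (by omega)
      have h2 := cost_le (D := D) hm f h.2 (by omega)
      have h4 := size_eval_le hm e h.1
      have h5 := size_eval_le hm f h.2
      simp only [cost, weight, add_mul]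
      omega
  | .sub e f, h, hD => by
      have h3 := size_eval_le hm (.sub e f) h
      simp only [weight, eval] at hD h3
      have h1 := cost_le (D := D) hm e h.1 (by omega)
      have h2 := cost_le (D := D) hm f h.2 (by omega)
      have h4 := size_eval_le hm e h.1
      have h5 := size_eval_le hm f h.2
      simp only [cost, weight, add_mul]
      omega
  | .mul e f, h, _ => h.elim
  | .div e f, h, hD => by
      have h3 := size_eval_le hm (.div e f) h
      simp only [weight, eval] at hD h3
      have h1 := cost_le (D := D) hm e h.1 (by omega)
      have h2 := cost_le (D := D) hm f h.2 (by omega)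
      have h4 := size_eval_le hm e h.1
      have h5 := size_eval_le hm f h.2
      simp only [cost, weight, add_mul]
      omega

/-- A run of `k` steps of a multiplication-free program makes numbers grow by `O(k)` bits only,
hence has a logarithmic cost that is quadratic in `k`. -/
theorem Run.exec {W D : ℕ} {c : Prog} {m m' : Mem} {k : ℕ} (h : Run c m m' k) :
    ∀ {B : ℕ}, c.Light W → (∀ a i, (m a i).size ≤ B) → B + W * k + W ≤ D →
      (∀ a i, (m' a i).size ≤ B + W * k) ∧
      ∃ t, Exec c m m' t ∧ t ≤ k * ((2 * W + 1) * (3 * D + 1)) := by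
  induction h with
  | skip m =>
    intro B _ hm _
    exact ⟨fun a i => (hm a i).trans (Nat.le_add_right _ _), 1, .skip m, by nlinarith⟩
  | set a idx e m =>
    intro B hc hm hD
    obtain ⟨⟨hi, hiW⟩, he, heW⟩ := hc
    have h1 := idx.size_eval_le hm hi
    have h2 := e.size_eval_le hm he
    have h3 := idx.cost_le hm hi (D := D) (by omega)
    have h4 := e.cost_le hm he (D := D) (by omega)
    refine ⟨fun b j => ?_, _, .set a idx e m, ?_⟩
    · unfold Mem.write
      split_ifs
      · omega
      · exact (hm b j).trans (Nat.le_add_right _ _)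
    · have h5 : idx.weight * (3 * D + 1) ≤ W * (3 * D + 1) := Nat.mul_le_mul_right _ hiW
      have h6 : e.weight * (3 * D + 1) ≤ W * (3 * D + 1) := Nat.mul_le_mul_right _ heW
      rw [one_mul, add_mul, mul_assoc]
      omega
  | @seq c d m m₁ m₂ k₁ k₂ _ _ ih₁ ih₂ =>
    intro B hc hm hD
    rw [mul_add] at hD
    obtain ⟨hm₁, t₁, e₁, ht₁⟩ := ih₁ hc.1 hm (by omega)
    obtain ⟨hm₂, t₂, e₂, ht₂⟩ := ih₂ hc.2 hm₁ (by omega)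
    refine ⟨fun a i => (hm₂ a i).trans (by rw [mul_add]; omega), _, .seq e₁ e₂, ?_⟩
    rw [add_mul]
    omega
  | @cond_true e c d m m₁ k he _ ih =>
    intro B hc hm hD
    rw [mul_add] at hD
    obtain ⟨hm₁, t₁, e₁, ht₁⟩ := ih hc.2.1 hm (by omega)
    have h3 := e.cost_le hm hc.1.1 (D := D) (by have := hc.1.2; omega)
    have h5 : e.weight * (3 * D + 1) ≤ W * (3 * D + 1) := Nat.mul_le_mul_right _ hc.1.2
    refine ⟨fun a i => (hm₁ a i).trans (by rw [mul_add]; omega), _, .cond_true he e₁, ?_⟩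
    rw [add_mul, one_mul, add_mul (2 * W), mul_assoc]
    rw [add_mul (2 * W), mul_assoc] at ht₁
    omega
  | @cond_false e c d m m₁ k he _ ih =>
    intro B hc hm hD
    rw [mul_add] at hD
    obtain ⟨hm₁, t₁, e₁, ht₁⟩ := ih hc.2.2 hm (by omega)
    have h3 := e.cost_le hm hc.1.1 (D := D) (by have := hc.1.2; omega)
    have h5 : e.weight * (3 * D + 1) ≤ W * (3 * D + 1) := Nat.mul_le_mul_right _ hc.1.2
    refine ⟨fun a i => (hm₁ a i).trans (by rw [mul_add]; omega), _, .cond_false he e₁, ?_⟩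
    rw [add_mul, one_mul, add_mul (2 * W), mul_assoc]
    rw [add_mul (2 * W), mul_assoc] at ht₁
    omega
  | @loop_true e c m m₁ m₂ k₁ k₂ he _ _ ih₁ ih₂ =>
    intro B hc hm hD
    rw [mul_add, mul_add] at hD
    obtain ⟨hm₁, t₁, e₁, ht₁⟩ := ih₁ hc.2 hm (by omega)
    obtain ⟨hm₂, t₂, e₂, ht₂⟩ := ih₂ hc hm₁ (by omega)
    have h3 := e.cost_le hm hc.1.1 (D := D) (by have := hc.1.2; omega)
    have h5 : e.weight * (3 * D + 1) ≤ W * (3 * D + 1) := Nat.mul_le_mul_right _ hc.1.2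
    refine ⟨fun a i => (hm₂ a i).trans (by rw [mul_add, mul_add]; omega), _,
      .loop_true he e₁ e₂, ?_⟩
    rw [add_mul, add_mul, one_mul, add_mul (2 * W), mul_assoc]
    rw [add_mul (2 * W), mul_assoc] at ht₁ ht₂
    omega
  | @loop_false e c m he =>
    intro B hc hm hD
    have h3 := e.cost_le hm hc.1.1 (D := D) (by have := hc.1.2; omega)
    have h5 : e.weight * (3 * D + 1) ≤ W * (3 * D + 1) := Nat.mul_le_mul_right _ hc.1.2
    refine ⟨fun a i => (hm a i).trans (Nat.le_add_right _ _), _, .loop_false he, ?_⟩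
    rw [one_mul, add_mul, mul_assoc]
    omega

/-! ### Weakest preconditions with step bounds -/

/-- Step bound of a program all of whose loops run at most `n` times. -/
def Prog.steps (n : ℕ) : Prog → ℕ
  | .skip => 1
  | .set _ _ _ => 1
  | .seq c d => c.steps n + d.steps n
  | .cond _ c d => 1 + (c.steps n + d.steps n)
  | .loop _ c => n * (1 + c.steps n) + 1

/-- The nesting of loops is fixed by the program, and each level contributes one factor `n`. -/
theorem Prog.exists_polynomial_steps (c : Prog) :
    ∃ p : Polynomial ℕ, ∀ n, c.steps n = p.eval n := by
  induction c with
  | skip => exact ⟨1, fun n => by simp [steps]⟩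
  | set => exact ⟨1, fun n => by simp [steps]⟩
  | seq c d hc hd =>
    obtain ⟨p, hp⟩ := hc
    obtain ⟨q, hq⟩ := hd
    exact ⟨p + q, fun n => by simp [steps, hp, hq]⟩
  | cond e c d hc hd =>
    obtain ⟨p, hp⟩ := hc
    obtain ⟨q, hq⟩ := hd
    exact ⟨1 + (p + q), fun n => by simp [steps, hp, hq]⟩
  | loop e c hc =>
    obtain ⟨p, hp⟩ := hc
    exact ⟨.X * (1 + p) + 1, fun n => by simp [steps, hp]⟩

theorem Prog.steps_mono (c : Prog) {n n' : ℕ} (h : n ≤ n') : c.steps n ≤ c.steps n' := by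
  induction c with
  | skip => rfl
  | set => rfl
  | seq c d hc hd => exact add_le_add hc hd
  | cond e c d hc hd => exact Nat.add_le_add_left (add_le_add hc hd) _
  | loop e c hc =>
    exact Nat.add_le_add_right (Nat.mul_le_mul h (Nat.add_le_add_left hc _)) _

/-- From `m`, the program `c` halts in a memory that satisfies `Q`, after at most `k` steps. -/
def Reaches (k : ℕ) (c : Prog) (Q : Mem → Prop) (m : Mem) : Prop :=
  ∃ m' k', Run c m m' k' ∧ k' ≤ k ∧ Q m'

/-- From `m`, the program `c` halts in a memory that satisfies `Q`, within its step bound. -/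
abbrev WP (n : ℕ) (c : Prog) (Q : Mem → Prop) (m : Mem) : Prop := Reaches (c.steps n) c Q m

section WP

variable {n : ℕ} {Q Q' : Mem → Prop} {m : Mem} {c d : Prog}

theorem Reaches.mono {k k' : ℕ} (h : Reaches k c Q m) (hk : k ≤ k')
    (hQ : ∀ m, Q m → Q' m) : Reaches k' c Q' m := by
  obtain ⟨m', j, hr, hj, hq⟩ := h
  exact ⟨m', j, hr, hj.trans hk, hQ _ hq⟩

theorem Reaches.seq {k l : ℕ} (h : Reaches k c (Reaches l d Q) m) :
    Reaches (k + l) (.seq c d) Q m := by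
  obtain ⟨m₁, k₁, h₁, hk₁, m₂, k₂, h₂, hk₂, hQ⟩ := h
  exact ⟨m₂, _, .seq h₁ h₂, add_le_add hk₁ hk₂, hQ⟩

theorem wp_skip (h : Q m) : WP n .skip Q m := ⟨m, 1, .skip m, le_rfl, h⟩

theorem wp_set {a : ℕ} {idx e : Expr} (h : Q (m.write a (idx.eval m) (e.eval m))) :
    WP n (.set a idx e) Q m := ⟨_, 1, .set a idx e m, le_rfl, h⟩

theorem wp_seq (h : WP n c (WP n d Q) m) : WP n (.seq c d) Q m := Reaches.seq h

theorem wp_cond {e : Expr} (hc : e.eval m ≠ 0 → WP n c Q m) (hd : e.eval m = 0 → WP n d Q m) :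
    WP n (.cond e c d) Q m := by
  by_cases he : e.eval m = 0
  · obtain ⟨m', k, h, hk, hQ⟩ := hd he
    exact ⟨m', _, .cond_false he h, by simp only [Prog.steps]; omega, hQ⟩
  · obtain ⟨m', k, h, hk, hQ⟩ := hc he
    exact ⟨m', _, .cond_true he h, by simp only [Prog.steps]; omega, hQ⟩

theorem WP.mono (h : WP n c Q m) (hQ : ∀ m, Q m → Q' m) : WP n c Q' m :=
  Reaches.mono h le_rfl hQ

/-- Total correctness of loops: `V` bounds the number of iterations. -/
theorem reaches_loop {e : Expr} {k : ℕ} (Inv : Mem → Prop) (V : Mem → ℕ)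
    (hbody : ∀ m, Inv m → e.eval m ≠ 0 → Reaches k c (fun m' => Inv m' ∧ V m' < V m) m)
    (hQ : ∀ m, Inv m → e.eval m = 0 → Q m) (hm : Inv m) :
    Reaches (V m * (1 + k) + 1) (.loop e c) Q m := by
  induction hv : V m using Nat.strong_induction_on generalizing m with
  | _ v ih =>
    subst hv
    by_cases he : e.eval m = 0
    · exact ⟨m, 1, .loop_false he, by omega, hQ m hm he⟩
    · obtain ⟨m₁, k₁, h₁, hk₁, hI, hlt⟩ := hbody m hm he
      obtain ⟨m₂, k₂, h₂, hk₂, hq⟩ := ih _ hlt hI rfl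
      refine ⟨m₂, _, .loop_true he h₁ h₂, ?_, hq⟩
      have : (V m₁ + 1) * (1 + k) ≤ V m * (1 + k) := Nat.mul_le_mul_right _ hlt
      rw [add_mul, one_mul] at this
      omega

end WP

/-! ### Scalar variables and counted loops -/

theorem Mem.write_apply (m : Mem) (a i x b : ℕ) :
    m.write a i x b = if b = a then Function.update (m b) i x else m b := by
  funext j
  by_cases h : b = a <;> by_cases h' : j = i <;> simp [Mem.write, h, h', Function.update]

/-- The scalar variable `a`, stored in cell `0` of array `a`. -/
abbrev Expr.var (a : ℕ) : Expr := .get a (.lit 0)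

/-- Assignment to a scalar variable. -/
abbrev Prog.assign (a : ℕ) (e : Expr) : Prog := .set a (.lit 0) e

/-- `c` is run for `a = 1, …, N`, where `N` is the value of the variable `N`. -/
abbrev Prog.forTo (a N : ℕ) (c : Prog) : Prog :=
  .seq (.assign a (.lit 0))
    (.loop (.sub (.var N) (.var a)) (.seq (.assign a (.add (.var a) (.lit 1))) c))

/-- The iteration bound `n` is the value of the variable `N`, which the body must preserve. `hwrite`
is needed because the counter is reset before the loop and advanced before each run of the body. -/
theorem wp_forTo {n a N : ℕ} {Q : Mem → Prop} {m : Mem} {c : Prog} (haN : a ≠ N)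
    (Inv : ℕ → Mem → Prop) (hN : m N 0 = n)
    (hstart : Inv 0 m) (hwrite : ∀ x m v, Inv x m → Inv x (m.write a 0 v))
    (hbody : ∀ x m, x < n → m N 0 = n → m a 0 = x + 1 → Inv x m →
      WP n c (fun m' => m' N 0 = n ∧ m' a 0 = x + 1 ∧ Inv (x + 1) m') m)
    (hQ : ∀ m, m N 0 = n → Inv n m → Q m) : WP n (.forTo a N c) Q m := by
  apply wp_seq
  apply wp_set
  have key := reaches_loop (e := .sub (.var N) (.var a))
    (c := .seq (.assign a (.add (.var a) (.lit 1))) c) (k := 1 + c.steps n) (Q := Q)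
    (fun m => m N 0 = n ∧ m a 0 ≤ n ∧ Inv (m a 0) m) (fun m => n - m a 0)
    (m := m.write a 0 0) ?_ ?_ ?_
  · refine Reaches.mono key ?_ (fun _ h => h)
    simp [Prog.steps, Mem.write]
  · rintro m ⟨h1, h2, h3⟩ he
    simp only [Expr.eval, h1] at he
    refine Reaches.seq (wp_set (n := n) ?_)
    refine (hbody (m a 0) _ (by omega) ?_ ?_ (hwrite _ _ _ h3)).mono ?_
    · simpa [Mem.write, haN.symm, Expr.eval] using h1
    · simp [Mem.write, Expr.eval]
    · rintro m' ⟨g1, g2, g3⟩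
      refine ⟨⟨g1, by omega, by rwa [g2]⟩, by omega⟩
  · rintro m ⟨h1, h2, h3⟩ he
    simp only [Expr.eval, h1] at he
    refine hQ m h1 ?_
    rwa [show m a 0 = n by omega] at h3
  · refine ⟨by simpa [Mem.write, haN.symm] using hN, by simp [Mem.write], ?_⟩
    simpa [Mem.write] using hwrite 0 m 0 hstart

end RAM

/-! ### Push and relabel steps for overfull assignments

Items and bins are numbered from `1` to `n`.  `b i` is the bin of item `i`, or `0` if item `i` is
not in any bin; `d` is a labelling of the bins. -/

namespace PushRelabel

variable {n : ℕ} {w c : ℕ → ℕ} {el : ℕ → ℕ → Prop} {b d : ℕ → ℕ}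

/-- Total weight of the items in bin `j`. -/
def binLoad (n : ℕ) (w b : ℕ → ℕ) (j : ℕ) : ℕ :=
  ∑ i ∈ range n, if b (i + 1) = j then w (i + 1) else 0

/-- Item `i` lies in a bin that remains overfull whichever of its items is removed. -/
def Active (n : ℕ) (w c b : ℕ → ℕ) (i : ℕ) : Prop :=
  b i ≠ 0 ∧ ∀ i', 1 ≤ i' → i' ≤ n → b i' = b i → c (b i) + w i' < binLoad n w b (b i)

/-- The invariant of the push-relabel algorithm. -/
structure Inv (n : ℕ) (w c : ℕ → ℕ) (el : ℕ → ℕ → Prop) (b d : ℕ → ℕ) : Prop where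
  bin_le : ∀ i, b i ≤ n
  el_bin : ∀ i, 1 ≤ i → i ≤ n → b i ≠ 0 → el i (b i)
  label : ∀ i j, 1 ≤ i → i ≤ n → 1 ≤ j → j ≤ n → b i ≠ 0 → el i j → d (b i) ≤ d j + 1
  outside : ∀ i j, 1 ≤ i → i ≤ n → 1 ≤ j → j ≤ n → b i = 0 → el i j → n + 1 ≤ d j
  full : ∀ j, 1 ≤ j → j ≤ n → 0 < d j → c j ≤ binLoad n w b j
  label_le : ∀ j, d j ≤ n + 2
  label_zero : d 0 = 0

/-- The potential that decreases in every step. -/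
def potential (n : ℕ) (b d : ℕ → ℕ) : ℕ :=
  ∑ i ∈ range n, d (b (i + 1)) + (n + 1) * ∑ j ∈ range n, (n + 2 - d (j + 1))

/-- The additive form covers the old bin, the new bin and all others without truncated subtraction.
-/
theorem binLoad_update {i : ℕ} (h1 : 1 ≤ i) (hn : i ≤ n) (j k : ℕ) :
    binLoad n w (Function.update b i j) k + (if b i = k then w i else 0) =
      binLoad n w b k + (if j = k then w i else 0) := by
  have hmem : i - 1 ∈ range n := by simp; omega
  have hi : i - 1 + 1 = i := by omega
  unfold binLoad
  rw [← add_sum_erase _ _ hmem, ← add_sum_erase (range n) _ hmem, hi, Function.update_self]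
  have : ∑ x ∈ (range n).erase (i - 1),
        (if Function.update b i j (x + 1) = k then w (x + 1) else 0) =
      ∑ x ∈ (range n).erase (i - 1), if b (x + 1) = k then w (x + 1) else 0 := by
    refine sum_congr rfl fun x hx => ?_
    have : x + 1 ≠ i := by
      have := (mem_erase.mp hx).1
      omega
    rw [Function.update_of_ne this]
  rw [this]
  omega

theorem Active.lt {i : ℕ} (h : Active n w c b i) (h1 : 1 ≤ i) (hn : i ≤ n) :
    c (b i) + w i < binLoad n w b (b i) := h.2 i h1 hn rfl

/-- Moving an item of an active bin to `j`, a bin of smaller label or the outside. -/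
theorem Inv.move (hI : Inv n w c el b d) {i j : ℕ} (h1 : 1 ≤ i) (hn : i ≤ n)
    (ha : Active n w c b i) (hj : j ≤ n) (hlt : d j < d (b i)) (hel : j ≠ 0 → el i j)
    (hlab : ∀ j', 1 ≤ j' → j' ≤ n → el i j' → d j ≤ d j' + 1)
    (hout : j = 0 → ∀ j', 1 ≤ j' → j' ≤ n → el i j' → n + 1 ≤ d j') :
    Inv n w c el (Function.update b i j) d ∧
      potential n (Function.update b i j) d < potential n b d := by
  refine ⟨⟨fun k => ?_, fun k k1 kn => ?_, fun k l k1 kn l1 ln => ?_, fun k l k1 kn l1 ln => ?_,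
    fun k k1 kn hk => ?_, hI.label_le, hI.label_zero⟩, ?_⟩
  · by_cases hk : k = i
    · simpa [hk] using hj
    · simpa [hk] using hI.bin_le k
  · by_cases hk : k = i
    · subst hk; simpa using hel
    · simpa [hk] using hI.el_bin k k1 kn
  · by_cases hk : k = i
    · subst hk; simpa using fun _ => hlab l l1 ln
    · simpa [hk] using hI.label k l k1 kn l1 ln
  · by_cases hk : k = i
    · subst hk; simpa using fun h => hout h l l1 ln
    · simpa [hk] using hI.outside k l k1 kn l1 ln
  -- Only the bin that `i` leaves loses weight, and being active it exceeds its capacity even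
  -- without `i`.
  · have h2 := binLoad_update (w := w) (b := b) h1 hn j k
    have h3 := ha.lt h1 hn
    have h4 := hI.full k k1 kn hk
    by_cases hki : b i = k
    · subst hki
      rw [if_pos rfl] at h2
      omega
    · rw [if_neg hki] at h2
      omega
  · refine Nat.add_lt_add_right (sum_lt_sum (fun x _ => ?_) ⟨i - 1, by simp; omega, ?_⟩) _
    · by_cases hk : x + 1 = i
      · rw [hk, Function.update_self]; exact hlt.le
      · rw [Function.update_of_ne hk]
    · rw [show i - 1 + 1 = i by omega, Function.update_self]; exact hlt

/-- Pushing an item of an active bin to an eligible bin of smaller label. -/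
theorem Inv.push (hI : Inv n w c el b d) {i j : ℕ} (h1 : 1 ≤ i) (hn : i ≤ n)
    (ha : Active n w c b i) (hj1 : 1 ≤ j) (hj : j ≤ n) (hel : el i j) (hlt : d j < d (b i)) :
    Inv n w c el (Function.update b i j) d ∧
      potential n (Function.update b i j) d < potential n b d :=
  hI.move h1 hn ha hj hlt (fun _ => hel)
    (fun j' k1 kn hk => hlt.le.trans (hI.label i j' h1 hn k1 kn ha.1 hk)) (by omega)

/-- Removing an item from an active bin of maximal label. -/
theorem Inv.remove (hI : Inv n w c el b d) {i : ℕ} (h1 : 1 ≤ i) (hn : i ≤ n)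
    (ha : Active n w c b i) (hmax : n + 2 ≤ d (b i)) :
    Inv n w c el (Function.update b i 0) d ∧
      potential n (Function.update b i 0) d < potential n b d :=
  hI.move h1 hn ha (Nat.zero_le _) (by rw [hI.label_zero]; omega) (fun h => (h rfl).elim)
    (fun j' _ _ _ => by rw [hI.label_zero]; omega)
    -- From label `n + 2` the label condition puts every bin eligible for `i` at `n + 1` or higher,
    -- as `outside` demands.
    (fun _ j' k1 kn hk => by have := hI.label i j' h1 hn k1 kn ha.1 hk; omega)

/-- Relabelling an active bin when no push is possible. -/
theorem Inv.relabel (hI : Inv n w c el b d) {i : ℕ} (h1 : 1 ≤ i) (hn : i ≤ n)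
    (ha : Active n w c b i) (hmax : d (b i) < n + 2)
    (hno : ∀ i' j, 1 ≤ i' → i' ≤ n → 1 ≤ j → j ≤ n → Active n w c b i' → el i' j →
      d (b i') ≤ d j) :
    Inv n w c el b (Function.update d (b i) (d (b i) + 1)) ∧
      potential n b (Function.update d (b i) (d (b i) + 1)) < potential n b d := by
  have hle : ∀ k, d k ≤ Function.update d (b i) (d (b i) + 1) k := fun k => by
    by_cases hk : k = b i
    · subst hk; simp
    · simp [hk]
  have hle' : ∀ k, Function.update d (b i) (d (b i) + 1) k ≤ d k + 1 := fun k => by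
    by_cases hk : k = b i
    · subst hk; simp
    · simp [hk]
  have hb := hI.bin_le i
  refine ⟨⟨hI.bin_le, hI.el_bin, fun k l k1 kn l1 ln h0 hel => ?_,
    fun k l k1 kn l1 ln h0 hel => (hI.outside k l k1 kn l1 ln h0 hel).trans (hle l),
    fun k k1 kn hk => ?_, fun k => ?_, ?_⟩, ?_⟩
  · by_cases hk : b k = b i
    -- Activity depends on the bin only, so `hno` applies to every item of the relabelled bin.
    · have hak : Active n w c b k := by rw [Active, hk]; exact ha
      have h3 := hno k l k1 kn l1 ln hak hel
      exact (hle' _).trans (Nat.add_le_add_right (h3.trans (hle l)) 1)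
    · rw [Function.update_of_ne hk]
      exact (hI.label k l k1 kn l1 ln h0 hel).trans (Nat.add_le_add_right (hle l) 1)
  · by_cases hki : k = b i
    · subst hki
      have := ha.lt h1 hn
      omega
    · rw [Function.update_of_ne hki] at hk
      exact hI.full k k1 kn hk
  · by_cases hk : k = b i
    · rw [hk, Function.update_self]; omega
    · rw [Function.update_of_ne hk]; exact hI.label_le k
  · rw [Function.update_of_ne (Ne.symm ha.1)]; exact hI.label_zero
  -- At most `n` items see the label of their bin rise by one; the weight `n + 1` of the second sum
  -- outweighs this.
  · have hs1 : ∑ x ∈ range n, Function.update d (b i) (d (b i) + 1) (b (x + 1)) ≤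
        ∑ x ∈ range n, d (b (x + 1)) + n := by
      refine (sum_le_sum fun x _ => hle' (b (x + 1))).trans ?_
      rw [sum_add_distrib]; simp
    have hs2 : ∑ x ∈ range n, (n + 2 - Function.update d (b i) (d (b i) + 1) (x + 1)) <
        ∑ x ∈ range n, (n + 2 - d (x + 1)) := by
      have hb0 := ha.1
      refine sum_lt_sum (fun x _ => Nat.sub_le_sub_left (hle _) _)
        ⟨b i - 1, by simp; omega, ?_⟩
      rw [show b i - 1 + 1 = b i by omega, Function.update_self]
      omega
    have h4 := Nat.mul_le_mul_left (n + 1) hs2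
    rw [Nat.succ_eq_add_one, mul_add, mul_one] at h4
    unfold potential
    omega

theorem Inv.potential_le (hI : Inv n w c el b d) :
    potential n b d ≤ n * (n + 2) + (n + 1) * (n * (n + 2)) := by
  refine add_le_add ?_ (Nat.mul_le_mul_left _ ?_)
  · simpa using sum_le_sum fun x (_ : x ∈ range n) => hI.label_le (b (x + 1))
  · simpa using sum_le_sum fun x (_ : x ∈ range n) => Nat.sub_le (n + 2) (d (x + 1))

/-- An item starts outside only if it fits nowhere, so `outside` is vacuous; zero labels settle the
conditions on labels. -/
theorem Inv.start (hb : ∀ i, b i ≤ n) (hel : ∀ i, 1 ≤ i → i ≤ n → b i ≠ 0 → el i (b i))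
    (hout : ∀ i j, 1 ≤ i → i ≤ n → 1 ≤ j → j ≤ n → b i = 0 → ¬ el i j) :
    Inv n w c el b (fun _ => 0) where
  bin_le := hb
  el_bin := hel
  label _ _ _ _ _ _ _ _ := Nat.zero_le _
  outside i j i1 hi j1 hj h0 he := (hout i j i1 hi j1 hj h0 he).elim
  full j _ _ h := by omega
  label_le _ := Nat.zero_le _
  label_zero := rfl

end PushRelabel

/-! ### The program: assignment phase -/

namespace RAM

open PushRelabel

/-- Memory contents during the assignment phase: input, row offsets of the adjacency matrix, stretch
factors, number of tasks, assignment, labels. -/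
structure Env (n : ℕ) (inp R al b d : ℕ → ℕ) (m : Mem) : Prop where
  inp : m 0 = inp
  row : m 2 = R
  al : m 17 = al
  num : m 18 0 = n
  bin : m 3 = b
  lab : m 4 = d

/-- Execution time. -/
abbrev wt (al : ℕ → ℕ) (i : ℕ) : ℕ := al i + (al i + al i)

/-- Item `i` fits into bin `j`, and they are joined by an arc. -/
abbrev Fits (inp R al : ℕ → ℕ) (i j : ℕ) : Prop := inp (R i + j) - (wt al i - al j) ≠ 0

/-- Expression for the execution time of the task `e`. -/
abbrev wtExpr (e : Expr) : Expr := .add (.get 17 e) (.add (.get 17 e) (.get 17 e))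

/-- Expression for `Fits`. -/
abbrev fitsExpr (e f : Expr) : Expr :=
  .sub (.get 0 (.add (.get 2 e) f)) (.sub (wtExpr e) (.get 17 f))

/-- Expression for the bin of the item `e`. -/
abbrev binExpr (e : Expr) : Expr := .get 3 e

/-- Every item is put into some bin in which it fits. -/
def startProg : Prog :=
  .forTo 10 18 (.forTo 11 18
    (.cond (fitsExpr (.var 10) (.var 11)) (.set 3 (.var 10) (.var 11)) .skip))

/-- Computation of the loads. -/
def loadProg : Prog :=
  .seq (.forTo 10 18 (.seq (.set 5 (.var 10) (.lit 0)) (.set 6 (.var 10) (.lit 0))))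
    (.forTo 10 18 (.set 5 (binExpr (.var 10))
      (.add (.get 5 (binExpr (.var 10))) (wtExpr (.var 10)))))

/-- Search, for every bin, for an item without which the bin is not overfull. -/
def extraProg : Prog :=
  .forTo 10 18 (.cond
    (.sub (.add (.add (.get 17 (binExpr (.var 10))) (wtExpr (.var 10))) (.lit 1))
      (.get 5 (binExpr (.var 10))))
    (.set 6 (binExpr (.var 10)) (.var 10)) .skip)

/-- Search for an active item and for a push. -/
def searchProg : Prog :=
  .seq (.assign 12 (.lit 0)) (.seq (.assign 14 (.lit 0))
    (.forTo 10 18 (.cond (binExpr (.var 10)) (.cond (.get 6 (binExpr (.var 10))) .skip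
      (.seq (.assign 14 (.var 10)) (.forTo 11 18
        (.cond (fitsExpr (.var 10) (.var 11))
          (.cond (.sub (.get 4 (binExpr (.var 10))) (.get 4 (.var 11)))
            (.seq (.assign 12 (.var 10)) (.assign 13 (.var 11))) .skip) .skip)))) .skip)))

/-- A push, a relabelling, or a removal. -/
def actProg : Prog :=
  .cond (.var 12) (.set 3 (.var 12) (.var 13)) (.cond (.var 14)
    (.cond (.sub (.add (.var 18) (.lit 2)) (.get 4 (binExpr (.var 14))))
      (.set 4 (binExpr (.var 14)) (.add (.get 4 (binExpr (.var 14))) (.lit 1)))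
      (.set 3 (.var 14) (.lit 0))) .skip)

/-- One iteration of the assignment phase. -/
def sweepProg : Prog := .seq loadProg (.seq extraProg (.seq searchProg actProg))

/-- `e` records the items found by `extraProg`. -/
def ExtraSpec (n : ℕ) (w c b e : ℕ → ℕ) : Prop :=
  ∀ j, 1 ≤ j → j ≤ n →
    (e j = 0 ∧ ∀ i, 1 ≤ i → i ≤ n → b i = j → c j + w i < binLoad n w b j) ∨
    (1 ≤ e j ∧ e j ≤ n ∧ b (e j) = j ∧ binLoad n w b j ≤ c j + w (e j))

/-! ### Correctness of the assignment phase -/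

variable {n : ℕ} {inp R al b d : ℕ → ℕ} {m : Mem}

theorem Env.write (h : Env n inp R al b d m) {a i v : ℕ}
    (ha : a ∉ [0, 2, 17, 18, 3, 4]) : Env n inp R al b d (m.write a i v) := by
  simp only [List.mem_cons, List.not_mem_nil, or_false, not_or] at ha
  obtain ⟨h0, h2, h17, h18, h3, h4⟩ := ha
  exact ⟨by rw [Mem.write_apply, if_neg (Ne.symm h0), h.inp],
    by rw [Mem.write_apply, if_neg (Ne.symm h2), h.row],
    by rw [Mem.write_apply, if_neg (Ne.symm h17), h.al],
    by rw [Mem.write_apply, if_neg (Ne.symm h18), h.num],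
    by rw [Mem.write_apply, if_neg (Ne.symm h3), h.bin],
    by rw [Mem.write_apply, if_neg (Ne.symm h4), h.lab]⟩

/-- The last fitting bin overwrites the earlier ones, so an item keeps the value `0` only if its
whole row contains no fit. -/
theorem wp_startProg (h : Env n inp R al (fun _ => 0) d m) :
    WP n startProg (fun m' => ∃ b, Env n inp R al b d m' ∧ (∀ i, b i ≤ n) ∧
      (∀ i, 1 ≤ i → i ≤ n → b i ≠ 0 → Fits inp R al i (b i)) ∧
      ∀ i j, 1 ≤ i → i ≤ n → 1 ≤ j → j ≤ n → b i = 0 → ¬ Fits inp R al i j) m := by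
  refine wp_forTo (by decide) (fun x m => ∃ b, Env n inp R al b d m ∧ (∀ i, b i ≤ n) ∧
      (∀ i, 1 ≤ i → i ≤ n → b i ≠ 0 → Fits inp R al i (b i)) ∧
      ∀ i j, 1 ≤ i → i ≤ x → 1 ≤ j → j ≤ n → b i = 0 → ¬ Fits inp R al i j) h.num ?_ ?_ ?_ ?_
  · exact ⟨_, h, fun _ => Nat.zero_le _, fun i _ _ h0 => (h0 rfl).elim, fun i j _ _ => by omega⟩
  · rintro x m v ⟨b, hb, hr⟩
    exact ⟨b, hb.write (by decide), hr⟩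
  · rintro x m hx hn h10 ⟨b, hb, hle, hfit, hall⟩
    refine wp_forTo (by decide) (fun y m => m 10 0 = x + 1 ∧ ∃ b, Env n inp R al b d m ∧
      (∀ i, b i ≤ n) ∧ (∀ i, 1 ≤ i → i ≤ n → b i ≠ 0 → Fits inp R al i (b i)) ∧
      (∀ i j, 1 ≤ i → i ≤ x → 1 ≤ j → j ≤ n → b i = 0 → ¬ Fits inp R al i j) ∧
      ∀ j, 1 ≤ j → j ≤ y → b (x + 1) = 0 → ¬ Fits inp R al (x + 1) j) hn ?_ ?_ ?_ ?_
    · exact ⟨h10, b, hb, hle, hfit, hall, fun j => by omega⟩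
    · rintro y m v ⟨h1, b, hb, hr⟩
      exact ⟨by simpa [Mem.write_apply] using h1, b, hb.write (by decide), hr⟩
    · rintro y m hy hn h11 ⟨h10, b, hb, hle, hfit, hall, hrow⟩
      have hev : (fitsExpr (.var 10) (.var 11)).eval m =
          inp (R (x + 1) + (y + 1)) - (wt al (x + 1) - al (y + 1)) := by
        simp [Expr.eval, h10, h11, hb.inp, hb.row, hb.al]
      refine wp_cond (fun he => wp_set ?_) (fun he => wp_skip ?_)
      · rw [hev] at he
        refine ⟨by simpa [Mem.write_apply] using hn, by simpa [Mem.write_apply] using h11,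
          by simpa [Mem.write_apply] using h10, Function.update b (x + 1) (y + 1),
          ⟨by simp [Mem.write_apply, hb.inp], by simp [Mem.write_apply, hb.row],
           by simp [Mem.write_apply, hb.al], by simp [Mem.write_apply, hb.num],
           by simp [Mem.write_apply, hb.bin, Expr.eval, h10, h11],
           by simp [Mem.write_apply, hb.lab]⟩, fun i => ?_, fun i i1 hi => ?_,
          fun i j i1 hi => ?_, fun j => by simp⟩
        · by_cases hi : i = x + 1
          · simp only [hi, Function.update_self]; omega
          · rw [Function.update_of_ne hi]; exact hle i
        · by_cases hi' : i = x + 1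
          · subst hi'; rw [Function.update_self]; exact fun _ => he
          · rw [Function.update_of_ne hi']; exact hfit i i1 hi
        · rw [Function.update_of_ne (by omega)]
          exact hall i j i1 hi
      · rw [hev] at he
        refine ⟨hn, h11, h10, b, hb, hle, hfit, hall, fun j j1 hj => ?_⟩
        by_cases hj' : j = y + 1
        · subst hj'; exact fun _ h => h he
        · exact hrow j j1 (by omega)
    · rintro m hn ⟨h10, b, hb, hle, hfit, hall, hrow⟩
      refine ⟨hn, h10, b, hb, hle, hfit, fun i j i1 hi j1 hj h0 => ?_⟩
      by_cases hi' : i = x + 1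
      · subst hi'; exact hrow j j1 hj h0
      · exact hall i j i1 (by omega) j1 hj h0
  · rintro m hn ⟨b, hb, hle, hfit, hall⟩
    exact ⟨b, hb, hle, hfit, hall⟩

/-- Items outside add their weight to cell `0`, which belongs to no bin; hence the restriction to `1
≤ j`. -/
theorem wp_loadProg (h : Env n inp R al b d m) :
    WP n loadProg (fun m' => Env n inp R al b d m' ∧
      ∀ j, 1 ≤ j → j ≤ n → m' 5 j = binLoad n (wt al) b j ∧ m' 6 j = 0) m := by
  refine wp_seq (wp_forTo (by decide) (fun x m => Env n inp R al b d m ∧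
      ∀ j, 1 ≤ j → j ≤ x → m 5 j = 0 ∧ m 6 j = 0) h.num ?_ ?_ ?_ ?_)
  · exact ⟨h, fun j => by omega⟩
  · rintro x m v ⟨hE, hr⟩
    exact ⟨hE.write (by decide), by simpa [Mem.write_apply] using hr⟩
  · rintro x m hx hn h10 ⟨hE, hr⟩
    refine wp_seq (wp_set (wp_set ⟨?_, ?_, (hE.write (by decide)).write (by decide),
      fun j j1 hj => ?_⟩))
    · simpa [Mem.write_apply] using hn
    · simpa [Mem.write_apply] using h10
    · by_cases hj' : j = x + 1
      · subst hj'; simp [Mem.write_apply, Expr.eval, h10]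
      · simpa [Mem.write_apply, Expr.eval, h10, hj'] using hr j j1 (by omega)
  · rintro m hn ⟨hE, hr⟩
    refine wp_forTo (by decide) (fun x m => Env n inp R al b d m ∧
      ∀ j, 1 ≤ j → j ≤ n → m 5 j = binLoad x (wt al) b j ∧ m 6 j = 0) hn ?_ ?_ ?_ ?_
    · exact ⟨hE, fun j j1 hj => by simpa [binLoad] using hr j j1 hj⟩
    · rintro x m v ⟨hE, hr⟩
      exact ⟨hE.write (by decide), by simpa [Mem.write_apply] using hr⟩
    · rintro x m hx hn h10 ⟨hE, hr⟩
      refine wp_set ⟨?_, ?_, hE.write (by decide), fun j j1 hj => ?_⟩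
      · simpa [Mem.write_apply] using hn
      · simpa [Mem.write_apply] using h10
      · have h2 := hr j j1 hj
        by_cases hj' : b (x + 1) = j
        · subst hj'
          simp [Mem.write_apply, Expr.eval, h10, hE.bin, hE.al, h2, binLoad, sum_range_succ]
        · simp [Mem.write_apply, Expr.eval, h10, hE.bin, hE.al, h2, binLoad, sum_range_succ, hj',
            Ne.symm hj']
    · exact fun m _ h => h

theorem wp_extraProg (h : Env n inp R al b d m)
    (hload : ∀ j, 1 ≤ j → j ≤ n → m 5 j = binLoad n (wt al) b j ∧ m 6 j = 0) :
    WP n extraProg (fun m' => Env n inp R al b d m' ∧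
      (∀ j, 1 ≤ j → j ≤ n → m' 5 j = binLoad n (wt al) b j) ∧
      ExtraSpec n (wt al) al b (m' 6)) m := by
  refine wp_forTo (by decide) (fun x m => Env n inp R al b d m ∧
      (∀ j, 1 ≤ j → j ≤ n → m 5 j = binLoad n (wt al) b j) ∧
      ∀ j, 1 ≤ j → j ≤ n →
      (m 6 j = 0 ∧ ∀ i, 1 ≤ i → i ≤ x → b i = j → al j + wt al i < binLoad n (wt al) b j) ∨
      (1 ≤ m 6 j ∧ m 6 j ≤ n ∧ b (m 6 j) = j ∧ binLoad n (wt al) b j ≤ al j + wt al (m 6 j)))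
      h.num ?_ ?_ ?_ ?_
  · exact ⟨h, fun j j1 hj => (hload j j1 hj).1, fun j j1 hj =>
      .inl ⟨(hload j j1 hj).2, fun i => by omega⟩⟩
  · rintro x m v ⟨hE, hl, hr⟩
    exact ⟨hE.write (by decide), by simpa [Mem.write_apply] using hl,
      by simpa [Mem.write_apply] using hr⟩
  · rintro x m hx hn h10 ⟨hE, hl, hr⟩
    have hev : (Expr.sub (.add (.add (.get 17 (binExpr (.var 10))) (wtExpr (.var 10))) (.lit 1))
      (.get 5 (binExpr (.var 10)))).eval m =
        al (b (x + 1)) + wt al (x + 1) + 1 - m 5 (b (x + 1)) := by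
      simp [Expr.eval, h10, hE.bin, hE.al]
    refine wp_cond (fun he => wp_set ?_) (fun he => wp_skip ?_) <;> rw [hev] at he
    · refine ⟨by simpa [Mem.write_apply] using hn, by simpa [Mem.write_apply] using h10,
        hE.write (by decide), by simpa [Mem.write_apply] using hl, fun j j1 hj => ?_⟩
      by_cases hj' : b (x + 1) = j
      · subst hj'
        right
        rw [hl _ j1 hj] at he
        have : (m.write 6 ((binExpr (.var 10)).eval m) ((Expr.var 10).eval m)) 6 (b (x + 1))
            = x + 1 := by simp [Mem.write_apply, Expr.eval, h10, hE.bin]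
        rw [this]
        exact ⟨by omega, by omega, rfl, by omega⟩
      · have : (m.write 6 ((binExpr (.var 10)).eval m) ((Expr.var 10).eval m)) 6 j = m 6 j := by
          simp [Mem.write_apply, Expr.eval, h10, hE.bin, Ne.symm hj']
        rw [this]
        refine (hr j j1 hj).imp (fun ⟨h1, h2⟩ => ⟨h1, fun i i1 hi hbi => ?_⟩) id
        refine h2 i i1 ?_ hbi
        have : i ≠ x + 1 := by rintro rfl; exact hj' hbi
        omega
    · refine ⟨hn, h10, hE, hl, fun j j1 hj => ?_⟩
      refine (hr j j1 hj).imp (fun ⟨h1, h2⟩ => ⟨h1, fun i i1 hi hbi => ?_⟩) id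
      by_cases hi' : i = x + 1
      · subst hi' hbi
        rw [hl _ j1 hj] at he
        omega
      · exact h2 i i1 (by omega) hbi
  · exact fun m _ h => h

/-- A recorded extra item is a witness against activity, so one array lookup decides a condition on
all items of the bin. -/
theorem ExtraSpec.active {w c e : ℕ → ℕ} (he : ExtraSpec n w c b e) (hb : ∀ i, b i ≤ n) {i : ℕ} :
    Active n w c b i ↔ b i ≠ 0 ∧ e (b i) = 0 := by
  refine and_congr_right fun h0 => ?_
  have hle := hb i
  rcases he (b i) (by omega) hle with ⟨h1, h2⟩ | ⟨h1, h2, h3, h4⟩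
  · exact ⟨fun _ => h1, fun _ => h2⟩
  · refine ⟨fun h => ?_, fun h => by omega⟩
    have := h _ h1 h2 h3
    omega

/-- Specification of `searchProg`. -/
structure SearchSpec (n : ℕ) (inp R al b d : ℕ → ℕ) (m : Mem) : Prop where
  active : m 14 0 ≠ 0 → m 14 0 ≤ n ∧ Active n (wt al) al b (m 14 0)
  none_active : m 14 0 = 0 → ∀ i, 1 ≤ i → i ≤ n → ¬ Active n (wt al) al b i
  push : m 12 0 ≠ 0 → m 12 0 ≤ n ∧ Active n (wt al) al b (m 12 0) ∧ 1 ≤ m 13 0 ∧ m 13 0 ≤ n ∧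
    Fits inp R al (m 12 0) (m 13 0) ∧ d (m 13 0) < d (b (m 12 0)) ∧ m 14 0 ≠ 0
  none_push : m 12 0 = 0 → ∀ i j, 1 ≤ i → i ≤ n → 1 ≤ j → j ≤ n → Active n (wt al) al b i →
    Fits inp R al i j → d (b i) ≤ d j

/-- The search runs over all active items even after a push has been found. When none is found,
`none_push` supplies the hypothesis `hno` of `Inv.relabel`. -/
theorem wp_searchProg (h : Env n inp R al b d m) (hb : ∀ i, b i ≤ n) {l : ℕ → ℕ}
    (hl : m 5 = l) {e : ℕ → ℕ} (hm : m 6 = e) (he : ExtraSpec n (wt al) al b e) :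
    WP n searchProg (fun m' => Env n inp R al b d m' ∧ m' 5 = l ∧ m' 6 = e ∧
      SearchSpec n inp R al b d m') m := by
  refine wp_seq (wp_set (wp_seq (wp_set (wp_forTo (by decide)
    (fun x m => Env n inp R al b d m ∧ m 5 = l ∧ m 6 = e ∧
      (m 14 0 ≠ 0 → m 14 0 ≤ n ∧ Active n (wt al) al b (m 14 0)) ∧
      (m 14 0 = 0 → ∀ i, 1 ≤ i → i ≤ x → ¬ Active n (wt al) al b i) ∧
      (m 12 0 ≠ 0 → m 12 0 ≤ n ∧ Active n (wt al) al b (m 12 0) ∧ 1 ≤ m 13 0 ∧ m 13 0 ≤ n ∧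
        Fits inp R al (m 12 0) (m 13 0) ∧ d (m 13 0) < d (b (m 12 0)) ∧ m 14 0 ≠ 0) ∧
      (m 12 0 = 0 → ∀ i j, 1 ≤ i → i ≤ x → 1 ≤ j → j ≤ n → Active n (wt al) al b i →
        Fits inp R al i j → d (b i) ≤ d j)) ?_ ?_ ?_ ?_ ?_))))
  · simpa [Mem.write_apply] using h.num
  · refine ⟨(h.write (by decide)).write (by decide), by simpa [Mem.write_apply] using hl,
      by simpa [Mem.write_apply] using hm, ?_, fun _ i => by omega, ?_, fun _ i j => by omega⟩
    · simp [Mem.write_apply, Expr.eval]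
    · simp [Mem.write_apply, Expr.eval]
  · rintro x m v ⟨hE, hr⟩
    exact ⟨hE.write (by decide), by simpa only [Mem.write_apply, reduceCtorEq, if_false,
      Nat.reduceEqDiff] using hr⟩
  · rintro x m hx hn h10 ⟨hE, hl, hm, h1, h2, h3, h4⟩
    have hev : (binExpr (.var 10)).eval m = b (x + 1) := by simp [Expr.eval, h10, hE.bin]
    refine wp_cond (fun h0 => wp_cond (fun h6 => wp_skip ?_) (fun h6 => ?_)) (fun h0 => wp_skip ?_)
    · have hna : ¬ Active n (wt al) al b (x + 1) := by
        rw [he.active hb]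
        simp only [Expr.eval, h10, hE.bin, hm] at h6
        tauto
      refine ⟨hn, h10, hE, hl, hm, h1, fun h0 i i1 hi => ?_, h3, fun h0 i j i1 hi => ?_⟩
      · by_cases hi' : i = x + 1
        · rwa [hi']
        · exact h2 h0 i i1 (by omega)
      · by_cases hi' : i = x + 1
        · rw [hi']; exact fun _ _ h => (hna h).elim
        · exact h4 h0 i j i1 (by omega)
    · have hact : Active n (wt al) al b (x + 1) := by
        rw [he.active hb]
        simp only [Expr.eval, h10, hE.bin, hm] at h6
        rw [hev] at h0
        exact ⟨h0, h6⟩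
      refine wp_seq (wp_set (wp_forTo (by decide)
        (fun y m => m 10 0 = x + 1 ∧ Env n inp R al b d m ∧ m 5 = l ∧ m 6 = e ∧ m 14 0 = x + 1 ∧
        (m 12 0 ≠ 0 → m 12 0 ≤ n ∧ Active n (wt al) al b (m 12 0) ∧ 1 ≤ m 13 0 ∧ m 13 0 ≤ n ∧
          Fits inp R al (m 12 0) (m 13 0) ∧ d (m 13 0) < d (b (m 12 0))) ∧
        (m 12 0 = 0 → ∀ i j, 1 ≤ i → i ≤ x → 1 ≤ j → j ≤ n → Active n (wt al) al b i →
          Fits inp R al i j → d (b i) ≤ d j) ∧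
        (m 12 0 = 0 → ∀ j, 1 ≤ j → j ≤ y → Fits inp R al (x + 1) j → d (b (x + 1)) ≤ d j))
        ?_ ?_ ?_ ?_ ?_))
      · simpa [Mem.write_apply] using hn
      · refine ⟨by simpa [Mem.write_apply] using h10, hE.write (by decide),
          by simpa [Mem.write_apply] using hl, by simpa [Mem.write_apply] using hm,
          by simp [Mem.write_apply, Expr.eval, h10], ?_, ?_, fun _ j => by omega⟩
        · simp only [Mem.write_apply, Nat.reduceEqDiff, if_false]
          exact fun h => ⟨(h3 h).1, (h3 h).2.1, (h3 h).2.2.1, (h3 h).2.2.2.1, (h3 h).2.2.2.2.1,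
            (h3 h).2.2.2.2.2.1⟩
        · simpa only [Mem.write_apply, Nat.reduceEqDiff, if_false] using h4
      · rintro y m v ⟨h10, hE, hr⟩
        exact ⟨by simpa [Mem.write_apply] using h10, hE.write (by decide),
          by simpa only [Mem.write_apply, Nat.reduceEqDiff, if_false]
            using hr⟩
      · rintro y m hy hn h11 ⟨h10, hE, hl, hm, h14, g3, g4, g5⟩
        have hskip : (Fits inp R al (x + 1) (y + 1) → d (b (x + 1)) ≤ d (y + 1)) →
            (fun m' : Mem => m' 18 0 = n ∧ m' 11 0 = y + 1 ∧ m' 10 0 = x + 1 ∧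
              Env n inp R al b d m' ∧ m' 5 = l ∧ m' 6 = e ∧ m' 14 0 = x + 1 ∧
              (m' 12 0 ≠ 0 → m' 12 0 ≤ n ∧ Active n (wt al) al b (m' 12 0) ∧ 1 ≤ m' 13 0 ∧
                m' 13 0 ≤ n ∧ Fits inp R al (m' 12 0) (m' 13 0) ∧
                d (m' 13 0) < d (b (m' 12 0))) ∧
              (m' 12 0 = 0 → ∀ i j, 1 ≤ i → i ≤ x → 1 ≤ j → j ≤ n →
                Active n (wt al) al b i → Fits inp R al i j → d (b i) ≤ d j) ∧
              (m' 12 0 = 0 → ∀ j, 1 ≤ j → j ≤ y + 1 → Fits inp R al (x + 1) j →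
                d (b (x + 1)) ≤ d j)) m := by
          refine fun hyp => ⟨hn, h11, h10, hE, hl, hm, h14, g3, g4, fun h0 j j1 hj => ?_⟩
          by_cases hj' : j = y + 1
          · rwa [hj']
          · exact g5 h0 j j1 (by omega)
        have hf : (fitsExpr (.var 10) (.var 11)).eval m =
            inp (R (x + 1) + (y + 1)) - (wt al (x + 1) - al (y + 1)) := by
          simp [Expr.eval, h10, h11, hE.inp, hE.row, hE.al]
        have hd : (Expr.sub (.get 4 (binExpr (.var 10))) (.get 4 (.var 11))).eval m =
            d (b (x + 1)) - d (y + 1) := by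
          simp [Expr.eval, h10, h11, hE.bin, hE.lab]
        refine wp_cond (fun c1 => wp_cond (fun c2 => wp_seq (wp_set (wp_set ?_)))
          (fun c2 => wp_skip (hskip fun _ => by omega)))
          (fun c1 => wp_skip (hskip fun hF => (hF (hf ▸ c1)).elim))
        rw [hf] at c1
        rw [hd] at c2
        simp only [Mem.write_apply, Expr.eval, Nat.reduceEqDiff, if_false,
          if_true, Function.update_self, h10, h11]
        refine ⟨hn, trivial, trivial, (hE.write (by decide)).write (by decide), hl, hm, h14,
          fun _ => ⟨by omega, hact, by omega, by omega, c1, by omega⟩,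
          fun h => h.elim, fun h => h.elim⟩
      · rintro m hn ⟨h10, hE, hl, hm, h14, g3, g4, g5⟩
        refine ⟨hn, h10, hE, hl, hm, fun _ => by rw [h14]; exact ⟨by omega, hact⟩,
          fun h => by omega, fun h => ?_, fun h0 i j i1 hi j1 hj => ?_⟩
        · obtain ⟨p1, p2, p3, p4, p5, p6⟩ := g3 h
          exact ⟨p1, p2, p3, p4, p5, p6, by omega⟩
        · by_cases hi' : i = x + 1
          · subst hi'; exact fun _ => g5 h0 j j1 hj
          · exact g4 h0 i j i1 (by omega) j1 hj
    · rw [hev] at h0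
      have hna : ¬ Active n (wt al) al b (x + 1) := fun h => h.1 h0
      refine ⟨hn, h10, hE, hl, hm, h1, fun h0 i i1 hi => ?_, h3, fun h0 i j i1 hi => ?_⟩
      · by_cases hi' : i = x + 1
        · rwa [hi']
        · exact h2 h0 i i1 (by omega)
      · by_cases hi' : i = x + 1
        · rw [hi']; exact fun _ _ h => (hna h).elim
        · exact h4 h0 i j i1 (by omega)
  · rintro m hn ⟨hE, hl, hm, h1, h2, h3, h4⟩
    exact ⟨hE, hl, hm, h1, h2, h3, h4⟩

/-- What the assignment phase guarantees in the end. -/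
def AssignSpec (n : ℕ) (inp R al : ℕ → ℕ) (m : Mem) : Prop :=
  ∃ b d, Env n inp R al b d m ∧ Inv n (wt al) al (Fits inp R al) b d ∧
    (m 14 0 = 0 → (∀ j, 1 ≤ j → j ≤ n → m 5 j = binLoad n (wt al) b j) ∧
      ExtraSpec n (wt al) al b (m 6) ∧ ∀ i, 1 ≤ i → i ≤ n → ¬ Active n (wt al) al b i)

/-- The last sweep finds no active item and leaves the potential unchanged; the summand for cell
`14` makes the measure drop there too. -/
theorem wp_sweepProg (h : AssignSpec n inp R al m) (h14 : m 14 0 ≠ 0) :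
    WP n sweepProg (fun m' => AssignSpec n inp R al m' ∧
      potential n (m' 3) (m' 4) + (if m' 14 0 = 0 then 0 else 1) <
        potential n (m 3) (m 4) + (if m 14 0 = 0 then 0 else 1)) m := by
  obtain ⟨b, d, hE, hI, -⟩ := h
  rw [hE.bin, hE.lab, if_neg h14]
  refine wp_seq ((wp_loadProg hE).mono fun m ⟨hE, hl⟩ => ?_)
  refine wp_seq ((wp_extraProg hE hl).mono fun m ⟨hE, hl, hx⟩ => ?_)
  refine wp_seq ((wp_searchProg hE hI.bin_le rfl rfl hx).mono fun m' ⟨hE, h5, h6, hs⟩ => ?_)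
  refine wp_cond (fun h12 => wp_set ?_) (fun h12 => wp_cond (fun h14 => ?_) (fun h14 => wp_skip ?_))
  · simp only [Expr.eval] at h12
    obtain ⟨p1, p2, p3, p4, p5, p6, p7⟩ := hs.push h12
    obtain ⟨hI', hlt⟩ := hI.push (Nat.one_le_iff_ne_zero.mpr h12) p1 p2 p3 p4 p5 p6
    simp only [AssignSpec, Mem.write_apply, Expr.eval, Nat.reduceEqDiff,
      if_false, if_true, hE.bin, hE.lab, if_neg p7]
    refine ⟨⟨_, d, ⟨?_, ?_, ?_, ?_, ?_, ?_⟩, hI', fun h => (p7 h).elim⟩, by omega⟩ <;>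
      simp [Mem.write_apply, hE.inp, hE.row, hE.al, hE.num, hE.bin, hE.lab]
  · simp only [Expr.eval] at h12 h14
    obtain ⟨p1, p2⟩ := hs.active h14
    have hev : (Expr.sub (.add (.var 18) (.lit 2)) (.get 4 (binExpr (.var 14)))).eval m' =
        n + 2 - d (b (m' 14 0)) := by
      simp [Expr.eval, hE.num, hE.bin, hE.lab]
    refine wp_cond (fun hd => wp_set ?_) (fun hd => wp_set ?_) <;> rw [hev] at hd
    · obtain ⟨hI', hlt⟩ := hI.relabel (Nat.one_le_iff_ne_zero.mpr h14) p1 p2 (by omega)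
        (hs.none_push h12)
      simp only [AssignSpec, Mem.write_apply, Expr.eval, Nat.reduceEqDiff,
        if_false, if_true, hE.bin, hE.lab, if_neg h14]
      refine ⟨⟨b, _, ⟨?_, ?_, ?_, ?_, ?_, ?_⟩, hI', fun h => (h14 h).elim⟩, by omega⟩ <;>
        simp [Mem.write_apply, hE.inp, hE.row, hE.al, hE.num, hE.bin, hE.lab]
    · obtain ⟨hI', hlt⟩ := hI.remove (Nat.one_le_iff_ne_zero.mpr h14) p1 p2 (by omega)
      simp only [AssignSpec, Mem.write_apply, Expr.eval, Nat.reduceEqDiff,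
        if_false, if_true, hE.bin, hE.lab, if_neg h14]
      refine ⟨⟨_, d, ⟨?_, ?_, ?_, ?_, ?_, ?_⟩, hI', fun h => (h14 h).elim⟩, by omega⟩ <;>
        simp [Mem.write_apply, hE.inp, hE.row, hE.al, hE.num, hE.bin, hE.lab]
  · simp only [Expr.eval] at h14
    rw [hE.bin, hE.lab, if_pos h14]
    refine ⟨⟨b, d, hE, hI, fun _ => ⟨by rwa [h5], by rwa [h6], hs.none_active h14⟩⟩, by omega⟩

/-- The assignment phase. -/
def assignProg : Prog := .seq startProg (.seq (.assign 14 (.lit 1)) (.loop (.var 14) sweepProg))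

/-- Step bound for the assignment phase. -/
def assignSteps (n : ℕ) : ℕ :=
  startProg.steps n +
    (1 + ((n * (n + 2) + (n + 1) * (n * (n + 2)) + 1) * (1 + sweepProg.steps n) + 1))

theorem reaches_assignProg (h : Env n inp R al (fun _ => 0) (fun _ => 0) m) :
    Reaches (assignSteps n) assignProg
      (fun m => AssignSpec n inp R al m ∧ m 14 0 = 0) m := by
  refine Reaches.seq ((wp_startProg h).mono fun m ⟨b, hE, hle, hfit, hall⟩ => ?_)
  refine Reaches.seq (k := 1) (wp_set (n := n) ?_)
  have hI : Inv n (wt al) al (Fits inp R al) b (fun _ => 0) := .start hle hfit hall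
  refine (reaches_loop (e := .var 14) (Q := fun m => AssignSpec n inp R al m ∧ m 14 0 = 0)
    (AssignSpec n inp R al) (fun m => potential n (m 3) (m 4) +
    (if m 14 0 = 0 then 0 else 1)) (fun m hm he => wp_sweepProg hm he)
    (fun m hm he => ⟨hm, he⟩) ?_).mono ?_ (fun _ h => h)
  · exact ⟨b, _, hE.write (by decide), hI, by simp [Mem.write_apply, Expr.eval]⟩
  · have := hI.potential_le
    refine Nat.add_le_add_right (Nat.mul_le_mul_right _ ?_) 1
    simp only [Mem.write_apply, Expr.eval, Nat.reduceEqDiff, if_false,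
      if_true, Function.update_self, hE.bin, hE.lab, one_ne_zero]
    omega

end RAM

/-! ### The program: initialization, merging and scheduling -/

namespace RAM

open PushRelabel

/-- Reading the input. -/
def initProg : Prog :=
  .seq (.assign 18 (.get 0 (.lit 0))) (.seq (.set 2 (.lit 0) (.var 18))
    (.forTo 10 18 (.seq (.set 17 (.var 10) (.get 0 (.add (.var 18) (.var 10))))
      (.set 2 (.var 10) (.add (.get 2 (.sub (.var 10) (.lit 1))) (.var 18))))))

/-- In every overfull bin, either the extra item or all the other items are kept. -/
def keepProg : Prog :=
  .seq (.set 8 (.lit 0) (.lit 0)) (.forTo 10 18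
    (.cond (.sub (.get 5 (binExpr (.var 10))) (.get 17 (binExpr (.var 10))))
      (.cond (.add (.sub (.var 10) (.get 6 (binExpr (.var 10))))
          (.sub (.get 6 (binExpr (.var 10))) (.var 10)))
        (.cond (.sub (.get 5 (binExpr (.var 10)))
            (.add (wtExpr (.get 6 (binExpr (.var 10)))) (wtExpr (.get 6 (binExpr (.var 10))))))
          (.set 8 (.var 10) (binExpr (.var 10))) (.set 8 (.var 10) (.lit 0)))
        (.cond (.sub (.get 5 (binExpr (.var 10)))
            (.add (wtExpr (.get 6 (binExpr (.var 10)))) (wtExpr (.get 6 (binExpr (.var 10))))))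
          (.set 8 (.var 10) (.lit 0)) (.set 8 (.var 10) (binExpr (.var 10)))))
      (.set 8 (.var 10) (binExpr (.var 10)))))

/-- Items are taken out of packed bins. -/
def mergeProg : Prog :=
  .forTo 10 18 (.cond (.get 8 (.get 8 (.var 10))) (.set 19 (.var 10) (.lit 0))
    (.set 19 (.var 10) (.get 8 (.var 10))))

/-- Starting times of the tasks that are not packed. -/
def rootProg : Prog :=
  .seq (.assign 20 (.lit 0)) (.forTo 10 18 (.cond (.get 19 (.var 10)) .skip
    (.seq (.set 9 (.var 10) (.var 20)) (.seq
      (.set 16 (.var 10) (.add (.var 20) (.get 17 (.var 10))))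
      (.assign 20 (.add (.var 20) (wtExpr (.var 10))))))))

/-- Starting times of the packed tasks. -/
def leafProg : Prog :=
  .forTo 10 18 (.cond (.get 19 (.var 10))
    (.seq (.set 9 (.var 10) (.get 16 (.get 19 (.var 10))))
      (.set 16 (.get 19 (.var 10)) (.add (.get 16 (.get 19 (.var 10))) (wtExpr (.var 10)))))
    .skip)

/-- Writing the output. -/
def outProg : Prog :=
  .seq (.forTo 10 18 (.set 0 (.sub (.var 10) (.lit 1)) (.get 9 (.var 10))))
    (.set 1 (.lit 0) (.var 18))

/-- Item `x` is kept, given the loads `l` and the extra items `e` of the bins. -/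
def Kept (al b l e : ℕ → ℕ) (x : ℕ) : Prop :=
  l (b x) ≤ al (b x) ∨ (x ≠ e (b x) ∧ wt al (e (b x)) + wt al (e (b x)) < l (b x)) ∨
    (x = e (b x) ∧ l (b x) ≤ wt al (e (b x)) + wt al (e (b x)))

/-- Starting times, when `p u` is the task into which `u` is packed (`0` if there is none). -/
def startTime (al p : ℕ → ℕ) (u : ℕ) : ℕ :=
  if p u = 0 then binLoad (u - 1) (wt al) p 0
  else binLoad (p u - 1) (wt al) p 0 + al (p u) + binLoad (u - 1) (wt al) p (p u)

/-! ### Correctness of initialization, merging and scheduling -/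

variable {n : ℕ} {inp R al b d pk p : ℕ → ℕ} {m : Mem}

/-- Row offsets are accumulated by adding `n` repeatedly, which avoids multiplication. Input cell `R
i + j` is the matrix entry in row `i` and column `j`, both counted from `1`. -/
theorem wp_initProg (h0 : m 0 = inp) (h1 : inp 0 = n) (h3 : m 3 = fun _ => 0)
    (h4 : m 4 = fun _ => 0) :
    WP n initProg (fun m' => ∃ R al, Env n inp R al (fun _ => 0) (fun _ => 0) m' ∧
      (∀ i, 1 ≤ i → i ≤ n → R i = n + i * n) ∧ ∀ i, 1 ≤ i → i ≤ n → al i = inp (n + i)) m := by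
  refine wp_seq (wp_set (wp_seq (wp_set (wp_forTo (by decide) (fun x m =>
    (m 0 = inp ∧ m 3 = (fun _ => 0) ∧ m 4 = fun _ => 0) ∧ (∀ i, i ≤ x → m 2 i = n + i * n) ∧
      ∀ i, 1 ≤ i → i ≤ x → m 17 i = inp (n + i)) ?_ ?_ ?_ ?_ ?_))))
  · simp [Mem.write_apply, Expr.eval, h0, h1]
  · refine ⟨by simp [Mem.write_apply, h0, h3, h4], fun i hi => ?_, fun i => by omega⟩
    obtain rfl : i = 0 := by omega
    simp [Mem.write_apply, Expr.eval, h0, h1]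
  · rintro x m v hr
    simpa [Mem.write_apply] using hr
  · rintro x m hx hn h10 ⟨hE, h2, h17⟩
    refine wp_seq (wp_set (wp_set ⟨?_, ?_, ?_, fun i hi => ?_, fun i i1 hi => ?_⟩))
    · simpa [Mem.write_apply] using hn
    · simpa [Mem.write_apply] using h10
    · simpa [Mem.write_apply] using hE
    · by_cases hi' : i = x + 1
      · subst hi'
        simp [Mem.write_apply, Expr.eval, h10, hn, h2 x le_rfl]
        ring
      · simpa [Mem.write_apply, Expr.eval, h10, hi'] using h2 i (by omega)
    · by_cases hi' : i = x + 1
      · subst hi'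
        simp [Mem.write_apply, Expr.eval, h10, hn, hE.1]
      · simpa [Mem.write_apply, Expr.eval, h10, hi'] using h17 i i1 (by omega)
  · rintro m hn ⟨⟨h0, h3, h4⟩, h2, h17⟩
    exact ⟨_, _, ⟨h0, rfl, rfl, hn, h3, h4⟩, fun i _ hi => h2 i hi, h17⟩

open Classical in
theorem wp_keepProg (h : Env n inp R al b d m) :
    WP n keepProg (fun m' => Env n inp R al b d m' ∧ m' 8 0 = 0 ∧
      ∀ x, 1 ≤ x → x ≤ n → m' 8 x = if Kept al b (m 5) (m 6) x then b x else 0) m := by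
  obtain ⟨l, hl⟩ : ∃ l, m 5 = l := ⟨_, rfl⟩
  obtain ⟨e, he⟩ : ∃ e, m 6 = e := ⟨_, rfl⟩
  rw [hl, he]
  refine wp_seq (wp_set (wp_forTo (by decide) (fun x m => (Env n inp R al b d m ∧ m 5 = l ∧
    m 6 = e) ∧ m 8 0 = 0 ∧ ∀ i, 1 ≤ i → i ≤ x → m 8 i = if Kept al b l e i then b i else 0)
    ?_ ?_ ?_ ?_ ?_))
  · simpa [Mem.write_apply] using h.num
  · exact ⟨⟨h.write (by decide), by simpa [Mem.write_apply] using hl,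
      by simpa [Mem.write_apply] using he⟩, by simp [Mem.write_apply, Expr.eval],
      fun i => by omega⟩
  · rintro x m v ⟨⟨hE, hl, he⟩, hr⟩
    exact ⟨⟨hE.write (by decide), by simpa [Mem.write_apply] using hl,
      by simpa [Mem.write_apply] using he⟩, by simpa [Mem.write_apply] using hr⟩
  · rintro x m hx hn h10 ⟨⟨hE, hl, he⟩, h80, h8⟩
    have key : ∀ f : Expr, f.eval m = (if Kept al b l e (x + 1) then b (x + 1) else 0) →
        WP n (.set 8 (.var 10) f) (fun m' => m' 18 0 = n ∧ m' 10 0 = x + 1 ∧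
          (Env n inp R al b d m' ∧ m' 5 = l ∧ m' 6 = e) ∧ m' 8 0 = 0 ∧
          ∀ i, 1 ≤ i → i ≤ x + 1 → m' 8 i = if Kept al b l e i then b i else 0) m := by
      intro f hf
      refine wp_set ⟨by simpa [Mem.write_apply] using hn, by simpa [Mem.write_apply] using h10,
        ⟨hE.write (by decide), by simpa [Mem.write_apply] using hl,
        by simpa [Mem.write_apply] using he⟩, by simpa [Mem.write_apply, Expr.eval, h10] using h80,
        fun i i1 hi => ?_⟩
      by_cases hi' : i = x + 1
      · subst hi'
        simpa [Mem.write_apply, Expr.eval, h10] using hf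
      · simpa [Mem.write_apply, Expr.eval, h10, hi'] using h8 i i1 (by omega)
    have hb : (binExpr (.var 10)).eval m = b (x + 1) := by simp [Expr.eval, h10, hE.bin]
    refine wp_cond (fun c1 => wp_cond (fun c2 => wp_cond (fun c3 => key _ ?_) (fun c3 => key _ ?_))
      (fun c2 => wp_cond (fun c3 => key _ ?_) (fun c3 => key _ ?_))) (fun c1 => key _ ?_)
    -- A branch that writes the bin has to prove `Kept`, one that writes `0` has to refute it; both
    -- are linear arithmetic in the branch conditions.
    all_goals
      first
      | rw [hb, eq_comm, if_pos]
      | rw [eq_comm, if_neg]; rfl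
      simp only [Expr.eval, h10, hE.bin, hE.al, hl, he] at *
      unfold Kept wt
      omega
  · exact fun m _ ⟨⟨hE, _⟩, hr⟩ => ⟨hE, hr⟩

theorem wp_mergeProg (h : Env n inp R al b d m) (h8 : m 8 = pk) :
    WP n mergeProg (fun m' => Env n inp R al b d m' ∧
      ∀ x, 1 ≤ x → x ≤ n → m' 19 x = if pk (pk x) = 0 then pk x else 0) m := by
  refine wp_forTo (by decide) (fun x m => (Env n inp R al b d m ∧ m 8 = pk) ∧
    ∀ i, 1 ≤ i → i ≤ x → m 19 i = if pk (pk i) = 0 then pk i else 0) h.num ?_ ?_ ?_ ?_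
  · exact ⟨⟨h, h8⟩, fun i => by omega⟩
  · rintro x m v ⟨⟨hE, h8⟩, hr⟩
    exact ⟨⟨hE.write (by decide), by simpa [Mem.write_apply] using h8⟩,
      by simpa [Mem.write_apply] using hr⟩
  · rintro x m hx hn h10 ⟨⟨hE, h8⟩, hr⟩
    refine wp_cond (fun c1 => wp_set ?_) (fun c1 => wp_set ?_) <;>
    · simp only [Expr.eval, h10, h8] at c1
      refine ⟨by simpa [Mem.write_apply] using hn, by simpa [Mem.write_apply] using h10,
        ⟨hE.write (by decide), by simpa [Mem.write_apply] using h8⟩, fun i i1 hi => ?_⟩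
      by_cases hi' : i = x + 1
      · subst hi'
        simp [Mem.write_apply, Expr.eval, h10, h8, c1]
      · simpa [Mem.write_apply, Expr.eval, h10, hi'] using hr i i1 (by omega)
  · exact fun m _ ⟨⟨hE, _⟩, hr⟩ => ⟨hE, hr⟩

theorem wp_rootProg (h : Env n inp R al b d m) (h19 : m 19 = p) :
    WP n rootProg (fun m' => (Env n inp R al b d m' ∧ m' 19 = p) ∧
      ∀ x, 1 ≤ x → x ≤ n → p x = 0 → m' 9 x = binLoad (x - 1) (wt al) p 0 ∧
        m' 16 x = binLoad (x - 1) (wt al) p 0 + al x) m := by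
  refine wp_seq (wp_set (wp_forTo (by decide) (fun x m => (Env n inp R al b d m ∧ m 19 = p) ∧
      m 20 0 = binLoad x (wt al) p 0 ∧
      ∀ i, 1 ≤ i → i ≤ x → p i = 0 → m 9 i = binLoad (i - 1) (wt al) p 0 ∧
        m 16 i = binLoad (i - 1) (wt al) p 0 + al i) ?_ ?_ ?_ ?_ ?_))
  · simpa [Mem.write_apply] using h.num
  · exact ⟨⟨h.write (by decide), by simpa [Mem.write_apply] using h19⟩,
      by simp [Mem.write_apply, Expr.eval, binLoad], fun i => by omega⟩
  · rintro x m v ⟨⟨hE, h19⟩, hr⟩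
    exact ⟨⟨hE.write (by decide), by simpa [Mem.write_apply] using h19⟩,
      by simpa [Mem.write_apply] using hr⟩
  · rintro x m hx hn h10 ⟨⟨hE, h19⟩, h20, hr⟩
    refine wp_cond (fun c1 => wp_skip ?_) (fun c1 => wp_seq (wp_set (wp_seq (wp_set (wp_set ?_)))))
      <;> simp only [Expr.eval, h10, h19] at c1
    · refine ⟨hn, h10, ⟨hE, h19⟩, ?_, fun i i1 hi hp => ?_⟩
      · rw [h20, binLoad, binLoad, sum_range_succ, if_neg c1, add_zero]
      · refine hr i i1 ?_ hp
        have : i ≠ x + 1 := by rintro rfl; exact c1 hp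
        omega
    · refine ⟨by simpa [Mem.write_apply] using hn, by simpa [Mem.write_apply] using h10,
        ⟨((hE.write (by decide)).write (by decide)).write (by decide),
        by simpa [Mem.write_apply] using h19⟩, ?_, fun i i1 hi hp => ?_⟩
      · simp [Mem.write_apply, Expr.eval, h10, h20, hE.al, binLoad, sum_range_succ, c1]
      · by_cases hi' : i = x + 1
        · subst hi'
          simp [Mem.write_apply, Expr.eval, h10, h20, hE.al]
        · simpa [Mem.write_apply, Expr.eval, h10, h20, hi'] using hr i i1 (by omega) hp
  · exact fun m _ ⟨hE, _, hr⟩ => ⟨hE, hr⟩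

/-- Cell `v` of array `16` holds the first moment still free in the idle time of the unpacked task
`v`. By `hp` every host is unpacked, so that cell has been initialized. -/
theorem wp_leafProg (h : Env n inp R al b d m) (h19 : m 19 = p)
    (hp : ∀ x, 1 ≤ x → x ≤ n → p x ≠ 0 → p x ≤ n ∧ p (p x) = 0)
    (hroot : ∀ x, 1 ≤ x → x ≤ n → p x = 0 → m 9 x = binLoad (x - 1) (wt al) p 0 ∧
        m 16 x = binLoad (x - 1) (wt al) p 0 + al x) :
    WP n leafProg (fun m' => Env n inp R al b d m' ∧
      ∀ x, 1 ≤ x → x ≤ n → m' 9 x = startTime al p x) m := by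
  refine wp_forTo (by decide) (fun x m => (Env n inp R al b d m ∧ m 19 = p) ∧
      (∀ v, 1 ≤ v → v ≤ n → p v = 0 →
        m 16 v = binLoad (v - 1) (wt al) p 0 + al v + binLoad x (wt al) p v) ∧
      ∀ i, 1 ≤ i → i ≤ n → (i ≤ x ∨ p i = 0) → m 9 i = startTime al p i) h.num ?_ ?_ ?_ ?_
  · refine ⟨⟨h, h19⟩, fun v v1 hv h0 => ?_, fun i i1 hi h0 => ?_⟩
    · simp [(hroot v v1 hv h0).2, binLoad]
    · have h0 : p i = 0 := by omega
      rw [startTime, if_pos h0, (hroot i i1 hi h0).1]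
  · rintro x m v ⟨⟨hE, h19⟩, hr⟩
    exact ⟨⟨hE.write (by decide), by simpa [Mem.write_apply] using h19⟩,
      by simpa [Mem.write_apply] using hr⟩
  · rintro x m hx hn h10 ⟨⟨hE, h19⟩, h16, hr⟩
    refine wp_cond (fun c1 => wp_seq (wp_set (wp_set ?_))) (fun c1 => wp_skip ?_)
      <;> simp only [Expr.eval, h10, h19] at c1
    · refine ⟨by simpa [Mem.write_apply] using hn, by simpa [Mem.write_apply] using h10,
        ⟨(hE.write (by decide)).write (by decide), by simpa [Mem.write_apply] using h19⟩,
        fun v v1 hv h0 => ?_, fun i i1 hi h0 => ?_⟩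
      · have h3 := h16 v v1 hv h0
        by_cases hv' : p (x + 1) = v
        · subst hv'
          simp [Mem.write_apply, Expr.eval, h10, h19, hE.al, h3, binLoad, sum_range_succ]
          ring
        · simp [Mem.write_apply, Expr.eval, h10, h19, h3, binLoad, sum_range_succ, hv',
            Ne.symm hv']
      · by_cases hi' : i = x + 1
        · subst hi'
          obtain ⟨hp1, hp2⟩ := hp (x + 1) (by omega) (by omega) c1
          simp [Mem.write_apply, Expr.eval, h10, h19, startTime, c1,
            h16 _ (Nat.one_le_iff_ne_zero.mpr c1) hp1 hp2]
        · have h3 := hr i i1 hi (by omega)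
          simpa [Mem.write_apply, Expr.eval, h10, hi'] using h3
    · refine ⟨hn, h10, ⟨hE, h19⟩, fun v v1 hv h0 => ?_, fun i i1 hi h0 => ?_⟩
      · rw [h16 v v1 hv h0, binLoad, binLoad, binLoad, sum_range_succ, c1, if_neg (by omega),
          add_zero]
      · by_cases hi' : i = x + 1
        · exact hr i i1 hi (.inr (hi' ▸ c1))
        · exact hr i i1 hi (by omega)
  · exact fun m _ ⟨⟨hE, _⟩, _, hr⟩ => ⟨hE, fun x x1 hx => hr x x1 hx (.inl hx)⟩

theorem wp_outProg (h : m 18 0 = n) {s : ℕ → ℕ} (hs : ∀ x, 1 ≤ x → x ≤ n → m 9 x = s x) :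
    WP n outProg (fun m' => m' 1 0 = n ∧ ∀ i, i < n → m' 0 i = s (i + 1)) m := by
  refine wp_seq (wp_forTo (by decide) (fun x m => (∀ x, 1 ≤ x → x ≤ n → m 9 x = s x) ∧
    ∀ i, i < x → m 0 i = s (i + 1)) h ?_ ?_ ?_ ?_)
  · exact ⟨hs, fun i => by omega⟩
  · rintro x m v hr
    simpa [Mem.write_apply] using hr
  · rintro x m hx hn h10 ⟨hs, hr⟩
    refine wp_set ⟨by simpa [Mem.write_apply] using hn, by simpa [Mem.write_apply] using h10,
      by simpa [Mem.write_apply] using hs, fun i hi => ?_⟩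
    by_cases hi' : i = x
    · subst hi'
      simpa [Mem.write_apply, Expr.eval, h10] using hs (i + 1) (by omega) (by omega)
    · simpa [Mem.write_apply, Expr.eval, h10, hi'] using hr i (by omega)
  · rintro m hn ⟨-, hr⟩
    refine wp_set ⟨by simpa [Mem.write_apply, Expr.eval] using hn, ?_⟩
    simpa [Mem.write_apply] using hr

/-! ### The complete program -/

/-- The whole algorithm. -/
def mainProg : Prog :=
  .seq initProg (.seq assignProg
    (.seq (.seq keepProg mergeProg) (.seq rootProg (.seq leafProg outProg))))

/-- Step bound for the whole algorithm. -/
def mainSteps (n : ℕ) : ℕ :=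
  initProg.steps n + (assignSteps n +
    (Prog.seq (.seq keepProg mergeProg) (.seq rootProg (.seq leafProg outProg))).steps n)

open Classical in
/-- What the algorithm computes: the starting times `s` for the input `inp`. -/
def MainSpec (n : ℕ) (inp s : ℕ → ℕ) : Prop :=
  ∃ R al b d e pk p : ℕ → ℕ, (∀ i, 1 ≤ i → i ≤ n → R i = n + i * n) ∧
    (∀ i, 1 ≤ i → i ≤ n → al i = inp (n + i)) ∧
    Inv n (wt al) al (Fits inp R al) b d ∧ ExtraSpec n (wt al) al b e ∧
    (∀ i, 1 ≤ i → i ≤ n → ¬ Active n (wt al) al b i) ∧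
    (pk 0 = 0 ∧ ∀ x, 1 ≤ x → x ≤ n →
      pk x = if Kept al b (binLoad n (wt al) b) e x then b x else 0) ∧
    (∀ x, 1 ≤ x → x ≤ n → p x = if pk (pk x) = 0 then pk x else 0) ∧
    ∀ i, i < n → s i = startTime al p (i + 1)

open Classical in
theorem reaches_mainProg (h0 : m 0 = inp) (h1 : inp 0 = n) (h3 : m 3 = fun _ => 0)
    (h4 : m 4 = fun _ => 0) :
    Reaches (mainSteps n) mainProg (fun m' => m' 1 0 = n ∧ MainSpec n inp (m' 0)) m := by
  refine Reaches.seq ((wp_initProg h0 h1 h3 h4).mono fun m ⟨R, al, hE, hR, hal⟩ => ?_)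
  refine Reaches.seq ((reaches_assignProg hE).mono le_rfl fun m ⟨⟨b, d, hE, hI, hS⟩, h14⟩ => ?_)
  obtain ⟨hl, he, hna⟩ := hS h14
  refine wp_seq (wp_seq ((wp_keepProg hE).mono fun m₁ ⟨hE, h80, h8⟩ => ?_))
  refine (wp_mergeProg hE rfl).mono fun m₂ ⟨hE, h19⟩ => ?_
  have hk : ∀ x, 1 ≤ x → x ≤ n →
      m₁ 8 x = if Kept al b (binLoad n (wt al) b) (m 6) x then b x else 0 := by
    intro x x1 hx
    rw [h8 x x1 hx]
    -- Loads are known only for the bins `1, …, n`; for an item outside, both branches give `0`.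
    by_cases h0 : b x = 0
    · simp [h0]
    · have := hl (b x) (by omega) (hI.bin_le x)
      exact if_congr (by simp only [Kept, this]) rfl rfl
  have hp : ∀ x, 1 ≤ x → x ≤ n → m₂ 19 x ≠ 0 → m₂ 19 x ≤ n ∧ m₂ 19 (m₂ 19 x) = 0 := by
    intro x x1 hx hne
    rw [h19 x x1 hx] at hne ⊢
    split_ifs at hne ⊢ with h
    · have hle : m₁ 8 x ≤ n := by
        rw [hk x x1 hx]
        split_ifs
        exacts [hI.bin_le x, Nat.zero_le _]
      exact ⟨hle, by rw [h19 _ (by omega) hle]; simp [h, h80]⟩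
    · exact (hne rfl).elim
  refine wp_seq ((wp_rootProg hE rfl).mono fun m₃ ⟨⟨hE, g19⟩, hr⟩ => ?_)
  refine wp_seq ((wp_leafProg hE g19 hp hr).mono fun m₄ ⟨hE, h9⟩ => ?_)
  refine (wp_outProg hE.num h9).mono fun m₅ ⟨g1, g0⟩ => ⟨g1, ?_⟩
  exact ⟨R, al, b, d, _, _, _, hR, hal, hI, he, hna, ⟨h80, hk⟩, h19, g0⟩

end RAM

/-! ### Running time -/

namespace RAM

theorem mainSteps_mono {n n' : ℕ} (h : n ≤ n') : mainSteps n ≤ mainSteps n' := by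
  unfold mainSteps assignSteps
  have h1 := fun c : Prog => c.steps_mono h
  have := h1 initProg
  have := h1 startProg
  have := h1 sweepProg
  have := h1 (Prog.seq (.seq keepProg mergeProg) (.seq rootProg (.seq leafProg outProg)))
  gcongr

theorem exists_polynomial_mainSteps : ∃ p : Polynomial ℕ, ∀ n, mainSteps n = p.eval n := by
  obtain ⟨p₁, h₁⟩ := initProg.exists_polynomial_steps
  obtain ⟨p₂, h₂⟩ := startProg.exists_polynomial_steps
  obtain ⟨p₃, h₃⟩ := sweepProg.exists_polynomial_steps
  obtain ⟨p₄, h₄⟩ := (Prog.seq (.seq keepProg mergeProg)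
    (.seq rootProg (.seq leafProg outProg))).exists_polynomial_steps
  refine ⟨p₁ + ((p₂ + (1 + ((.X * (.X + 2) + (.X + 1) * (.X * (.X + 2)) + 1) * (1 + p₃) + 1))) +
    p₄), fun n => ?_⟩
  simp [mainSteps, assignSteps, h₁, h₂, h₃, h₄]

theorem mulFree_mainProg : mainProg.MulFree := by
  simp [mainProg, initProg, assignProg, startProg, sweepProg, loadProg, extraProg, searchProg,
    actProg, keepProg, mergeProg, rootProg, leafProg, outProg, Prog.MulFree, Expr.MulFree]

theorem length_le_bitLength (L : List ℕ) : L.length ≤ bitLength L := by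
  induction L with
  | nil => simp [bitLength]
  | cons a L ih =>
    simp only [bitLength, List.map_cons, List.sum_cons, List.length_cons] at *
    omega

theorem size_le_bitLength {L : List ℕ} {x : ℕ} (h : x ∈ L) : x.size ≤ bitLength L :=
  (Nat.le_succ _).trans (List.single_le_sum (by simp) _
    (List.mem_map_of_mem (f := fun x : ℕ => x.size + 1) h))

theorem size_load_le (L : List ℕ) (a i : ℕ) : (load L a i).size ≤ bitLength L := by
  unfold load
  split
  · rw [List.getD_eq_getElem?_getD]
    by_cases h : i < L.length
    · rw [List.getElem?_eq_getElem h]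
      exact size_le_bitLength (List.getElem_mem h)
    · rw [List.getElem?_eq_none (by omega)]
      simp
  · exact (Nat.size_le.mpr Nat.lt_two_pow_self).trans (length_le_bitLength L)
  · simp

/-- On every input whose length is at least its first entry, the algorithm meets its
specification within polynomial time. -/
theorem exists_exec_mainProg : ∃ p : Polynomial ℕ, ∀ L : List ℕ, L.getD 0 0 ≤ L.length →
    ∃ m t, Exec mainProg (load L) m t ∧ t ≤ p.eval (bitLength L) ∧ m 1 0 = L.getD 0 0 ∧
      MainSpec (L.getD 0 0) (fun i => L.getD i 0) (m 0) := by
  obtain ⟨q, hq⟩ := exists_polynomial_mainSteps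
  obtain ⟨W, hW⟩ : ∃ W, mainProg.maxWeight = W := ⟨_, rfl⟩
  -- This is the cost bound of `Run.exec` for `q` steps from cells of at most `X` bits, where `X`
  -- stands for the input length.
  refine ⟨q * (((2 * W + 1 : ℕ) : Polynomial ℕ) * (3 * (.X + (W : Polynomial ℕ) * q +
    (W : Polynomial ℕ)) + 1)), fun L hL => ?_⟩
  obtain ⟨m, k, hrun, hk, h1, hspec⟩ := reaches_mainProg (m := load L)
    (inp := fun i => L.getD i 0) rfl rfl (by funext i; rfl) (by funext i; rfl)
  have hk' := hk.trans (mainSteps_mono (hL.trans (length_le_bitLength L)))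
  obtain ⟨-, t, hex, ht⟩ := hrun.exec (mulFree_mainProg.light hW.le) (size_load_le L) le_rfl
  refine ⟨m, t, hex, ht.trans ?_, h1, hspec⟩
  rw [hq] at hk'
  simp only [Polynomial.eval_mul, Polynomial.eval_add, Polynomial.eval_natCast,
    Polynomial.eval_one, Polynomial.eval_X, Polynomial.eval_ofNat]
  push_cast
  gcongr

end RAM

/-! ### Schedules -/

/-- Disjoint intervals inside `[a, b]` have total length at most `b - a`. -/
theorem sum_length_le {ι : Type*} (F : Finset ι) (s ℓ : ι → ℝ≥0) (a b : ℝ≥0) (hab : a ≤ b)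
    (hpos : ∀ u ∈ F, 0 < ℓ u) (hin : ∀ u ∈ F, a ≤ s u ∧ s u + ℓ u ≤ b)
    (hsep : ∀ u ∈ F, ∀ v ∈ F, u ≠ v → s u + ℓ u ≤ s v ∨ s v + ℓ v ≤ s u) :
    a + ∑ u ∈ F, ℓ u ≤ b := by
  classical
  induction F using Finset.induction_on_max_value s generalizing b with
  | empty => simpa using hab
  | insert x F hx hmax ih =>
    have h1 := ih (s x) (hin x (mem_insert_self _ _)).1
      (fun u hu => hpos u (mem_insert_of_mem hu))
      (fun u hu => ⟨(hin u (mem_insert_of_mem hu)).1, ?_⟩)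
      (fun u hu v hv => hsep u (mem_insert_of_mem hu) v (mem_insert_of_mem hv))
    · rw [sum_insert hx, add_comm (ℓ x), ← add_assoc]
      exact (add_le_add_left h1 _).trans (hin x (mem_insert_self _ _)).2
    · rcases hsep u (mem_insert_of_mem hu) x (mem_insert_self _ _)
        (by rintro rfl; exact hx hu) with h | h
      · exact h
      -- As `x` starts last and has positive length, it cannot end before another interval begins.
      · have h2 := hmax u hu
        have h3 := hpos x (mem_insert_self _ _)
        exact absurd (h.trans h2) (not_le.mpr (lt_add_of_pos_right _ h3))

namespace TwoStage

variable {I : TwoStage}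

theorem seq_union {X Y : Finset (Fin I.n)} (h : Disjoint X Y) :
    I.seq (X ∪ Y) = I.seq X + I.seq Y := sum_union h

theorem seq_mono {X Y : Finset (Fin I.n)} (h : X ⊆ Y) : I.seq X ≤ I.seq Y :=
  sum_le_sum_of_subset h

theorem sum_seq_fiber (f : Fin I.n → Option (Fin I.n)) (S : Finset (Fin I.n)) :
    ∑ v ∈ S, I.seq (univ.filter fun u => f u = some v) =
      I.seq (univ.filter fun u => ∃ v ∈ S, f u = some v) := by
  unfold seq
  rw [← sum_biUnion]
  · congr 1
    ext u
    simp
  · intro v _ w _ hvw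
    simp only [Function.onFun]
    rw [disjoint_filter]
    intro u _ h1 h2
    exact hvw (Option.some_injective _ (h1.symm.trans h2))

theorem not_compatible_of_layer_eq {u v : Fin I.n} (h : I.layer u = I.layer v) :
    ¬ I.Compatible u v := by
  rintro (h1 | h1)
  · have := I.arc_layer u v h1
    rw [h] at this
    omega
  · have := I.arc_layer v u h1
    rw [h] at this
    omega

theorem disjoint_of_le {σ : I.Schedule} {u v : Fin I.n} (h : σ u + 3 * I.α u ≤ σ v) :
    Disjoint (window σ u) (window σ v) ∧
      Disjoint (first σ u ∪ second σ u) (first σ v ∪ second σ v) := by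
  have hsub : ∀ w, first σ w ∪ second σ w ⊆ window σ w := by
    intro w x hx
    rcases hx with hx | hx
    · exact ⟨hx.1, hx.2.trans_le (by gcongr; exact le_mul_of_one_le_left' (by norm_num))⟩
    · exact ⟨le_self_add.trans hx.1, hx.2⟩
  have hw : Disjoint (window σ u) (window σ v) := by
    rw [window, window, Set.Ico_disjoint_Ico]
    exact (min_le_left _ _).trans (h.trans (le_max_right _ _))
  exact ⟨hw, hw.mono (hsub u) (hsub v)⟩

/-! #### Schedules of forests of depth one -/

/-- Starting time of the unpacked task `v` when the unpacked tasks of `A` are executed one after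
the other. -/
def rootTime (A : Finset (Fin I.n)) (p : Fin I.n → Option (Fin I.n)) (v : Fin I.n) : ℕ :=
  I.seq (A.filter fun x => p x = none ∧ x < v)

/-- Starting times, when `p u` is the task into which `u` is packed. -/
def time (A : Finset (Fin I.n)) (p : Fin I.n → Option (Fin I.n)) (u : Fin I.n) : ℕ :=
  match p u with
  | none => rootTime A p u
  | some v => rootTime A p v + I.α v + I.seq (univ.filter fun x => p x = some v ∧ x < u)

/-- `p` packs tasks of `A` along arcs into tasks of `A` that are not packed themselves. -/
structure IsForest (A : Finset (Fin I.n)) (p : Fin I.n → Option (Fin I.n)) : Prop where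
  arc : ∀ u v, p u = some v → I.arc u v = true
  root : ∀ u v, p u = some v → p v = none
  cap : ∀ v, I.seq (univ.filter fun u => p u = some v) ≤ I.α v
  mem : ∀ u v, u ∈ A → p u = some v → v ∈ A

variable {A : Finset (Fin I.n)} {p : Fin I.n → Option (Fin I.n)}

/-- Starting times are prefix sums in index order, so this says that `u` ends before `v` starts. -/
theorem seq_filter_lt_add (S : Finset (Fin I.n)) {u v : Fin I.n} (hu : u ∈ S)
    {q : Fin I.n → Prop} [DecidablePred q] (hq : q u) (huv : u < v) :
    I.seq (S.filter fun x => q x ∧ x < u) + 3 * I.α u ≤ I.seq (S.filter fun x => q x ∧ x < v) := by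
  have hnot : u ∉ S.filter fun x => q x ∧ x < u := by simp
  rw [add_comm, seq, ← sum_insert (f := fun u => 3 * I.α u) hnot]
  refine sum_le_sum_of_subset fun x hx => ?_
  rw [mem_insert, mem_filter] at hx
  rw [mem_filter]
  rcases hx with rfl | ⟨h1, h2, h3⟩
  · exact ⟨hu, hq, huv⟩
  · exact ⟨h1, h2, h3.trans huv⟩

theorem seq_filter_lt_add_le (S : Finset (Fin I.n)) {u : Fin I.n} (hu : u ∈ S)
    {q : Fin I.n → Prop} [DecidablePred q] (hq : q u) :
    I.seq (S.filter fun x => q x ∧ x < u) + 3 * I.α u ≤ I.seq (S.filter q) := by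
  have hnot : u ∉ S.filter fun x => q x ∧ x < u := by simp
  rw [add_comm, seq, ← sum_insert (f := fun u => 3 * I.α u) hnot]
  refine sum_le_sum_of_subset fun x hx => ?_
  rw [mem_insert, mem_filter] at hx
  rw [mem_filter]
  rcases hx with rfl | ⟨h1, h2, h3⟩
  · exact ⟨hu, hq⟩
  · exact ⟨h1, h2⟩

theorem time_root {u : Fin I.n} (h : p u = none) : time A p u = rootTime A p u := by
  simp only [time, h]

theorem time_leaf {u v : Fin I.n} (h : p u = some v) :
    time A p u =
      rootTime A p v + I.α v + I.seq (univ.filter fun x => p x = some v ∧ x < u) := by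
  simp only [time, h]

/-- The unpacked task during whose window `u` is executed. -/
def top (p : Fin I.n → Option (Fin I.n)) (u : Fin I.n) : Fin I.n := (p u).getD u

theorem IsForest.leaf (hp : IsForest A p) {u v : Fin I.n} (h : p u = some v) :
    time A p v + I.α v ≤ time A p u ∧ time A p u + 3 * I.α u ≤ time A p v + 2 * I.α v := by
  rw [time_root (hp.root u v h), time_leaf h]
  have h1 := seq_filter_lt_add_le univ (mem_univ u) (q := fun x => p x = some v) h
  have h2 := hp.cap v
  omega

theorem IsForest.top_root (hp : IsForest A p) (u : Fin I.n) : p (top p u) = none := by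
  cases h : p u with
  | none => simp [top, h]
  | some v => simpa [top, h] using hp.root u v h

theorem IsForest.top_mem (hp : IsForest A p) {u : Fin I.n} (hu : u ∈ A) : top p u ∈ A := by
  cases h : p u with
  | none => simpa [top, h] using hu
  | some v => simpa [top, h] using hp.mem u v hu h

theorem IsForest.top_window (hp : IsForest A p) (u : Fin I.n) :
    time A p (top p u) ≤ time A p u ∧
      time A p u + 3 * I.α u ≤ time A p (top p u) + 3 * I.α (top p u) := by
  cases h : p u with
  | none => simp [top, h]
  | some v =>
    have := hp.leaf h
    simp only [top, h, Option.getD_some]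
    omega

/-- Each task runs inside the window of its `top`, and the windows of distinct unpacked tasks follow
one another in index order. -/
theorem IsForest.sep (hp : IsForest A p) {u v : Fin I.n} (hu : u ∈ A) (hv : v ∈ A)
    (h : top p u ≠ top p v) :
    time A p u + 3 * I.α u ≤ time A p v ∨ time A p v + 3 * I.α v ≤ time A p u := by
  have key : ∀ x y, x ∈ A → y ∈ A → top p x < top p y →
      time A p x + 3 * I.α x ≤ time A p y := by
    intro x y hx hy hlt
    have h1 := hp.top_window x
    have h2 := hp.top_window y
    have h3 := seq_filter_lt_add A (hp.top_mem hx) (q := fun x => p x = none) (hp.top_root x) hlt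
    have h4 := time_root (A := A) (hp.top_root x)
    have h5 := time_root (A := A) (hp.top_root y)
    unfold rootTime at h4 h5
    omega
  rcases lt_or_gt_of_ne h with h | h
  · exact .inl (key u v hu hv h)
  · exact .inr (key v u hv hu h)

/-- Tasks with different tops are separated in time. With a common top, either one is the host of
the other and an arc joins them, or both fill the same idle time at successive prefix sums. -/
theorem IsForest.feasible (hp : IsForest A p) {σ : I.Schedule} (hσ : ∀ u, σ u = time A p u) :
    Feasible A σ := by
  have cast : ∀ u v, time A p u + 3 * I.α u ≤ time A p v → σ u + 3 * I.α u ≤ σ v := by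
    intro u v h
    rw [hσ, hσ]
    exact_mod_cast h
  have hsep : ∀ u v, time A p u + 3 * I.α u ≤ time A p v ∨ time A p v + 3 * I.α v ≤ time A p u →
      Disjoint (first σ u ∪ second σ u) (first σ v ∪ second σ v) ∧
      (¬ I.Compatible u v → Disjoint (window σ u) (window σ v)) := by
    rintro u v (h | h)
    · exact ⟨(disjoint_of_le (cast u v h)).2, fun _ => (disjoint_of_le (cast u v h)).1⟩
    · exact ⟨(disjoint_of_le (cast v u h)).2.symm, fun _ => (disjoint_of_le (cast v u h)).1.symm⟩
  have hleaf : ∀ u v, p u = some v →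
      Disjoint (first σ u ∪ second σ u) (first σ v ∪ second σ v) := by
    intro u v h
    obtain ⟨h1, h2⟩ := hp.leaf h
    have h1' : σ v + I.α v ≤ σ u := by rw [hσ, hσ]; exact_mod_cast h1
    have h2' : σ u + 3 * I.α u ≤ σ v + 2 * I.α v := by rw [hσ, hσ]; exact_mod_cast h2
    rw [Set.disjoint_left]
    intro x hx hy
    have hx1 : σ u ≤ x := by
      rcases hx with hx | hx
      · exact hx.1
      · exact le_self_add.trans hx.1
    have hx2 : x < σ u + 3 * I.α u := by
      rcases hx with hx | hx
      · exact hx.2.trans_le (by gcongr; exact le_mul_of_one_le_left' (by norm_num))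
      · exact hx.2
    rcases hy with hy | hy
    · exact absurd (hy.2.trans_le (h1'.trans hx1)) (lt_irrefl _)
    · exact absurd (hx2.trans_le (h2'.trans hy.1)) (lt_irrefl _)
  intro u hu v hv huv
  by_cases ht : top p u = top p v
  · cases h : p u with
    | none =>
      cases h' : p v with
      | none => simp [top, h, h', huv] at ht
      | some w =>
        obtain rfl : u = w := by simpa [top, h, h'] using ht
        exact ⟨(hleaf v u h').symm, fun hc => (hc (.inr (hp.arc v u h'))).elim⟩
    | some w =>
      cases h' : p v with
      | none =>
        obtain rfl : w = v := by simpa [top, h, h'] using ht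
        exact ⟨hleaf u w h, fun hc => (hc (.inl (hp.arc u w h))).elim⟩
      | some w' =>
        obtain rfl : w = w' := by simpa [top, h, h'] using ht
        refine hsep u v ?_
        rw [time_leaf h, time_leaf h']
        rcases lt_or_gt_of_ne huv with hlt | hlt
        · have := seq_filter_lt_add univ (mem_univ u) (q := fun x => p x = some w) h hlt
          omega
        · have := seq_filter_lt_add univ (mem_univ v) (q := fun x => p x = some w) h' hlt
          omega
  · exact hsep u v (hp.sep hu hv ht)

theorem IsForest.makespan_eq (hp : IsForest A p) {σ : I.Schedule}
    (hσ : ∀ u, σ u = time A p u) :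
    makespan A σ = I.seq (A.filter fun u => p u = none) := by
  apply le_antisymm
  · refine Finset.sup_le fun u hu => ?_
    have h1 := hp.top_window u
    have h2 := seq_filter_lt_add_le A (hp.top_mem hu) (q := fun x => p x = none) (hp.top_root u)
    rw [time_root (hp.top_root u), rootTime] at h1
    have h3 : time A p u + 3 * I.α u ≤ I.seq (A.filter fun u => p u = none) := by omega
    rw [hσ]
    exact_mod_cast h3
  · by_cases hne : (A.filter fun u => p u = none).Nonempty
    -- The unpacked task of largest index completes when all the unpacked work is done.
    · obtain ⟨r, hr, hmax⟩ := exists_max_image _ id hne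
      have hrA := (mem_filter.mp hr).1
      have hr0 := (mem_filter.mp hr).2
      refine le_trans ?_ (Finset.le_sup (f := fun u => σ u + 3 * (I.α u : ℝ≥0)) hrA)
      have h3 : I.seq (A.filter fun u => p u = none) ≤ time A p r + 3 * I.α r := by
        have hnot : r ∉ A.filter fun x => p x = none ∧ x < r := by simp
        rw [time_root hr0, rootTime, add_comm, seq, seq,
          ← sum_insert (f := fun u => 3 * I.α u) hnot]
        refine sum_le_sum_of_subset fun x hx => ?_
        rcases (hmax x hx).eq_or_lt with h | h
        · exact mem_insert.mpr (.inl h)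
        · refine mem_insert_of_mem (mem_filter.mpr ⟨(mem_filter.mp hx).1, (mem_filter.mp hx).2, h⟩)
      simp only [hσ]
      exact_mod_cast h3
    · rw [not_nonempty_iff_eq_empty] at hne
      simp [hne, seq]

/-- No packing arises by accident. The arc gives `v` positive length, so `u` cannot be separated
from the window of `v`; layers and arc orientation exclude the other ways of sharing a top. This
also covers `u` of length `0`. -/
theorem IsForest.packedInto_iff (hp : IsForest univ p) {σ : I.Schedule}
    (hσ : ∀ u, σ u = time univ p u) {u v : Fin I.n} :
    PackedInto σ u v ↔ p u = some v := by
  have hiff : PackedInto σ u v ↔ I.arc u v = true ∧ time univ p v + I.α v ≤ time univ p u ∧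
      time univ p u + 3 * I.α u ≤ time univ p v + 2 * I.α v := by
    unfold PackedInto
    rw [hσ, hσ]
    norm_cast
  rw [hiff]
  refine ⟨fun ⟨h1, h2, h3⟩ => ?_, fun h => ⟨hp.arc u v h, hp.leaf h⟩⟩
  have hlt := I.arc_lt u v h1
  have hl := I.arc_layer u v h1
  by_cases ht : top p u = top p v
  · cases h : p u with
    | none =>
      exfalso
      cases h' : p v with
      | none =>
        have : u = v := by simpa [top, h, h'] using ht
        rw [this] at hlt
        exact lt_irrefl _ hlt
      | some w =>
        obtain rfl : u = w := by simpa [top, h, h'] using ht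
        have := I.arc_lt v u (hp.arc v u h')
        omega
    | some w =>
      cases h' : p v with
      | none =>
        have : w = v := by simpa [top, h, h'] using ht
        rw [this]
      | some w' =>
        obtain rfl : w = w' := by simpa [top, h, h'] using ht
        have := I.arc_layer v w (hp.arc v w h')
        have := I.arc_layer u w (hp.arc u w h)
        omega
  · have := hp.sep (mem_univ u) (mem_univ v) ht
    omega

/-! #### Lower bounds -/

section Lower

variable {τ : I.Schedule}

theorem le_or_le_of_disjoint {a b c d : ℝ≥0} (hab : a < b) (hcd : c < d)
    (h : Disjoint (Set.Ico a b) (Set.Ico c d)) : b ≤ c ∨ d ≤ a := by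
  rw [Set.Ico_disjoint_Ico] at h
  rcases min_le_iff.mp h with h | h <;> rcases le_max_iff.mp h with h | h
  · exact absurd h (not_le.mpr hab)
  · exact .inl h
  · exact .inr h
  · exact absurd h (not_le.mpr hcd)

/-- The idle time of `u` is shorter than a sub-task of `v`, so no sub-task of `v` fits between the
two of `u`; any arrangement beyond the three listed would need that. -/
theorem Feasible.sep_of_arc (hτ : Feasible A τ) {u v : Fin I.n} (hu : u ∈ A) (hv : v ∈ A)
    (hpos : 0 < I.α u) (harc : I.arc u v = true) :
    τ u + 3 * I.α u ≤ τ v ∨ τ v + 3 * I.α v ≤ τ u ∨ PackedInto τ u v := by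
  have hlt := I.arc_lt u v harc
  have huv : u ≠ v := by rintro rfl; exact lt_irrefl _ hlt
  have hd := (hτ u hu v hv huv).1
  rw [Set.disjoint_union_left, Set.disjoint_union_right, Set.disjoint_union_right] at hd
  obtain ⟨⟨ff, fs⟩, sf, ss⟩ := hd
  have ha : (0 : ℝ) < I.α u := by exact_mod_cast hpos
  have hab : (I.α u : ℝ) < I.α v := by exact_mod_cast hlt
  have l1 : ∀ w, (0 : ℝ) < I.α w → τ w < τ w + I.α w := fun w hw => by
    rw [← NNReal.coe_lt_coe]; push_cast; linarith
  have l2 : ∀ w, (0 : ℝ) < I.α w → τ w + 2 * I.α w < τ w + 3 * I.α w := fun w hw => by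
    rw [← NNReal.coe_lt_coe]; push_cast; linarith
  have hb := ha.trans hab
  have ff := le_or_le_of_disjoint (l1 u ha) (l1 v hb) ff
  have fs := le_or_le_of_disjoint (l1 u ha) (l2 v hb) fs
  have sf := le_or_le_of_disjoint (l2 u ha) (l1 v hb) sf
  have ss := le_or_le_of_disjoint (l2 u ha) (l2 v hb) ss
  unfold PackedInto
  simp only [harc, true_and]
  simp only [← NNReal.coe_le_coe] at *
  push_cast at *
  rcases ff with h1 | h1
  · rcases sf with h2 | h2
    · exact .inl h2
    · linarith
  · rcases ss with h2 | h2
    · exact .inr (.inr ⟨h1, h2⟩)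
    · rcases fs with h3 | h3
      · linarith
      · exact .inr (.inl h3)

theorem Feasible.sep_of_not_compatible (hτ : Feasible A τ) {u v : Fin I.n} (hu : u ∈ A)
    (hv : v ∈ A) (huv : u ≠ v) (hu0 : 0 < I.α u) (hv0 : 0 < I.α v) (hc : ¬ I.Compatible u v) :
    τ u + 3 * I.α u ≤ τ v ∨ τ v + 3 * I.α v ≤ τ u := by
  have l : ∀ w, 0 < I.α w → τ w < τ w + 3 * I.α w := fun w hw => by
    have : (0 : ℝ≥0) < I.α w := by exact_mod_cast hw
    exact lt_add_of_pos_right _ (by positivity)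
  exact le_or_le_of_disjoint (l u hu0) (l v hv0) ((hτ u hu v hv huv).2 hc)

theorem Feasible.sep (hτ : Feasible A τ) {u v : Fin I.n} (hu : u ∈ A)
    (hv : v ∈ A) (huv : u ≠ v) (hu0 : 0 < I.α u) (hv0 : 0 < I.α v)
    (h1 : ¬ PackedInto τ u v) (h2 : ¬ PackedInto τ v u) :
    τ u + 3 * I.α u ≤ τ v ∨ τ v + 3 * I.α v ≤ τ u := by
  by_cases hc : I.Compatible u v
  · rcases hc with hc | hc
    · have := hτ.sep_of_arc hu hv hu0 hc
      tauto
    · have := hτ.sep_of_arc hv hu hv0 hc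
      tauto
  · exact hτ.sep_of_not_compatible hu hv huv hu0 hv0 hc

open Classical in
/-- The tasks that are not packed into any other task. -/
noncomputable def unpacked (A : Finset (Fin I.n)) (τ : I.Schedule) : Finset (Fin I.n) :=
  A.filter fun u => ¬ ∃ v ∈ A, PackedInto τ u v

theorem seq_filter_pos (X : Finset (Fin I.n)) :
    I.seq (X.filter fun u => 0 < I.α u) = I.seq X := by
  refine sum_subset (filter_subset _ _) fun u hu hn => ?_
  have : ¬ 0 < I.α u := fun h => hn (mem_filter.mpr ⟨hu, h⟩)
  omega

theorem seq_cast (X : Finset (Fin I.n)) : (I.seq X : ℝ≥0) = ∑ u ∈ X, 3 * (I.α u : ℝ≥0) := by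
  simp [seq]

/-- Unpacked tasks are pairwise separated even when compatible. Tasks of length `0` have empty
windows and no guaranteed position; they are dropped first, at no cost. -/
theorem Feasible.seq_unpacked_le (hτ : Feasible A τ) :
    (I.seq (unpacked A τ) : ℝ≥0) ≤ makespan A τ := by
  classical
  rw [← seq_filter_pos, seq_cast, ← zero_add (∑ _ ∈ _, _)]
  refine sum_length_le _ τ (fun u => 3 * (I.α u : ℝ≥0)) 0 _ zero_le ?_ ?_ ?_
  · intro u hu
    have : (0 : ℝ≥0) < I.α u := by exact_mod_cast (mem_filter.mp hu).2
    positivity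
  · intro u hu
    exact ⟨zero_le, Finset.le_sup (f := fun u => τ u + 3 * (I.α u : ℝ≥0))
      (mem_filter.mp (mem_filter.mp hu).1).1⟩
  · intro u hu v hv huv
    obtain ⟨hu, hu0⟩ := mem_filter.mp hu
    obtain ⟨hv, hv0⟩ := mem_filter.mp hv
    obtain ⟨huA, hu⟩ := mem_filter.mp hu
    obtain ⟨hvA, hv⟩ := mem_filter.mp hv
    exact hτ.sep huA hvA huv hu0 hv0 (fun h => hu ⟨v, hvA, h⟩) (fun h => hv ⟨u, huA, h⟩)

theorem seq_eq_unpacked_add (A : Finset (Fin I.n)) (τ : I.Schedule) :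
    I.seq A = I.seq (unpacked A τ) + I.seq (packed A τ 0) + I.seq (packed A τ 1) := by
  classical
  rw [← seq_union, ← seq_union]
  · congr 1
    ext u
    simp only [unpacked, packed, mem_union, mem_filter]
    constructor
    · intro hu
      by_cases h : ∃ v ∈ A, PackedInto τ u v
      · obtain ⟨v, hv, hp⟩ := h
        have hl := I.arc_layer u v hp.1
        have hl2 := (I.layer v).isLt
        have : I.layer u = 0 ∨ I.layer u = 1 := by
          rw [Fin.ext_iff, Fin.ext_iff]
          simp
          omega
        rcases this with h | h
        · exact .inl (.inr ⟨hu, h, v, hv, hp⟩)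
        · exact .inr ⟨hu, h, v, hv, hp⟩
      · exact .inl (.inl ⟨hu, h⟩)
    · tauto
  · rw [disjoint_left]
    intro u hu hu'
    simp only [unpacked, packed, mem_union, mem_filter] at hu hu'
    rcases hu with hu | hu
    · exact hu.2 hu'.2.2
    · have := hu.2.1.symm.trans hu'.2.1
      simp at this
  · rw [disjoint_left]
    intro u hu hu'
    simp only [unpacked, packed, mem_filter] at hu hu'
    exact hu.2 hu'.2.2

open Classical in
/-- A task into which `u` is packed (nothing for tasks of length `0`). -/
noncomputable def host (A : Finset (Fin I.n)) (τ : I.Schedule) (u : Fin I.n) :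
    Option (Fin I.n) :=
  if h : u ∈ A ∧ 0 < I.α u ∧ ∃ v ∈ A, PackedInto τ u v then some h.2.2.choose else none

theorem host_eq_some {u v : Fin I.n} (h : host A τ u = some v) :
    u ∈ A ∧ 0 < I.α u ∧ v ∈ A ∧ PackedInto τ u v := by
  unfold host at h
  split_ifs at h with h'
  obtain rfl := Option.some_injective _ h
  exact ⟨h'.1, h'.2.1, h'.2.2.choose_spec⟩

theorem host_ne_none_iff {u : Fin I.n} :
    host A τ u ≠ none ↔ u ∈ A ∧ 0 < I.α u ∧ ∃ v ∈ A, PackedInto τ u v := by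
  unfold host
  split_ifs with h
  · simpa using h
  · simpa using h

/-- Tasks with the same host lie in the same layer, hence are incompatible and run one after another
in an idle time of length `α v`. -/
theorem Feasible.seq_host_le (hτ : Feasible A τ) (v : Fin I.n) :
    I.seq (univ.filter fun u => host A τ u = some v) ≤ I.α v := by
  have key : τ v + I.α v + ∑ u ∈ univ.filter fun u => host A τ u = some v, 3 * (I.α u : ℝ≥0) ≤
      τ v + 2 * I.α v := by
    refine sum_length_le _ τ (fun u => 3 * (I.α u : ℝ≥0)) _ _ ?_ ?_ ?_ ?_
    · gcongr
      exact le_mul_of_one_le_left' (by norm_num)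
    · intro u hu
      have : (0 : ℝ≥0) < I.α u := by
        exact_mod_cast (host_eq_some (mem_filter.mp hu).2).2.1
      positivity
    · intro u hu
      exact (host_eq_some (mem_filter.mp hu).2).2.2.2.2
    · intro u hu w hw huw
      obtain ⟨hu, hu0, hv, hp⟩ := host_eq_some (mem_filter.mp hu).2
      obtain ⟨hw, hw0, -, hp'⟩ := host_eq_some (mem_filter.mp hw).2
      refine hτ.sep_of_not_compatible hu hw huw hu0 hw0 (not_compatible_of_layer_eq ?_)
      have h1 := I.arc_layer u v hp.1
      have h2 := I.arc_layer w v hp'.1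
      exact Fin.ext (by omega)
  rw [← seq_cast, two_mul, ← add_assoc] at key
  exact_mod_cast le_of_add_le_add_left key

/-- The packing of stage `i` that corresponds to the schedule `τ`. -/
noncomputable def stageHost (A : Finset (Fin I.n)) (τ : I.Schedule) (i : Fin 3) (u : Fin I.n) :
    Option (Fin I.n) :=
  if I.layer u = i then host A τ u else none

theorem Feasible.isPacking_stageHost (hτ : Feasible A τ) (i : Fin 3) :
    IsPacking i (stageHost A τ i) := by
  have hs : ∀ u v, stageHost A τ i u = some v → I.layer u = i ∧ host A τ u = some v := by
    intro u v h
    unfold stageHost at h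
    split_ifs at h with hl
    exact ⟨hl, h⟩
  refine ⟨fun u v h => ⟨(hs u v h).1, (host_eq_some (hs u v h).2).2.2.2.1⟩, fun v => ?_⟩
  refine (seq_mono fun u hu => ?_).trans (hτ.seq_host_le v)
  rw [mem_filter] at hu ⊢
  exact ⟨hu.1, (hs u v hu.2).2⟩

theorem profit_stageHost (A : Finset (Fin I.n)) (τ : I.Schedule) (i : Fin 3) :
    profit (stageHost A τ i) = I.seq (packed A τ i) := by
  rw [profit, ← seq_filter_pos (packed A τ i)]
  congr 1
  ext u
  rw [mem_filter, mem_filter]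
  simp only [mem_filter, mem_univ, true_and, packed, stageHost]
  by_cases h : I.layer u = i
  · simp only [h, if_true, host_ne_none_iff, true_and]
    tauto
  · simp [h]

/-- The host of a packed task of positive length is unpacked: otherwise a task of `V₀` would run
inside the window of a task of `V₂`, with which it is incompatible. The packed work thus fits into
the idle times of unpacked tasks, a third of their total duration. -/
theorem Feasible.seq_packed_le (hτ : Feasible univ τ) :
    3 * ((I.seq (packed univ τ 0) : ℝ≥0) + I.seq (packed univ τ 1)) ≤ makespan univ τ := by
  refine le_trans ?_ hτ.seq_unpacked_le
  have h1 : I.seq (packed univ τ 0) + I.seq (packed univ τ 1) ≤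
      ∑ v ∈ unpacked univ τ, I.seq (univ.filter fun u => host univ τ u = some v) := by
    classical
    rw [sum_seq_fiber, ← profit_stageHost, ← profit_stageHost, profit, profit, ← seq_union]
    · refine seq_mono fun u hu => ?_
      have hne : host univ τ u ≠ none := by
        rw [mem_union, mem_filter, mem_filter] at hu
        rcases hu with hu | hu
        · exact fun h => hu.2 (by simp [stageHost, h])
        · exact fun h => hu.2 (by simp [stageHost, h])
      obtain ⟨v, hv⟩ := Option.ne_none_iff_exists'.mp hne
      refine mem_filter.mpr ⟨mem_univ _, v, mem_filter.mpr ⟨mem_univ _, ?_⟩, hv⟩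
      rintro ⟨w, -, hw⟩
      obtain ⟨-, hu0, -, hp⟩ := host_eq_some hv
      have ha := I.arc_lt _ _ hp.1
      have ha' := I.arc_lt _ _ hw.1
      have hl := I.arc_layer _ _ hp.1
      have hl' := I.arc_layer _ _ hw.1
      have hc : ¬ I.Compatible u w := by
        rintro (h | h)
        · have := I.arc_layer _ _ h
          omega
        · have := I.arc_layer _ _ h
          omega
      have hsep := hτ.sep_of_not_compatible (mem_univ u) (mem_univ w) (by rintro rfl; omega) hu0
        (by omega) hc
      obtain ⟨-, p1, p2⟩ := hp
      obtain ⟨-, q1, q2⟩ := hw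
      have h0 : (0 : ℝ) < I.α u := by exact_mod_cast hu0
      have h0' : (0 : ℝ) < I.α v := by exact_mod_cast (show 0 < I.α v by omega)
      have h0'' : (0 : ℝ) < I.α w := by exact_mod_cast (show 0 < I.α w by omega)
      simp only [← NNReal.coe_le_coe] at *
      push_cast at *
      rcases hsep with h | h <;> linarith
    · rw [disjoint_left]
      intro u hu hu'
      rw [mem_filter] at hu hu'
      by_cases h : I.layer u = 0
      · exact hu'.2 (by simp [stageHost, h])
      · exact hu.2 (by simp [stageHost, h])
  have h2 : ∑ v ∈ unpacked univ τ, I.seq (univ.filter fun u => host univ τ u = some v) ≤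
      ∑ v ∈ unpacked univ τ, I.α v := sum_le_sum fun v _ => hτ.seq_host_le v
  have h3 : 3 * (I.seq (packed univ τ 0) + I.seq (packed univ τ 1)) ≤ I.seq (unpacked univ τ) := by
    have h4 : I.seq (unpacked univ τ) = 3 * ∑ v ∈ unpacked univ τ, I.α v := (mul_sum _ _ _).symm
    omega
  exact_mod_cast h3

end Lower

end TwoStage

/-! ### Half-approximate packings and their merge -/

namespace TwoStage

variable {I : TwoStage}

theorem seq_union_le (X Y : Finset (Fin I.n)) : I.seq (X ∪ Y) ≤ I.seq X + I.seq Y := by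
  have : I.seq (X ∪ Y) + I.seq (X ∩ Y) = I.seq X + I.seq Y := sum_union_inter
  omega

/-- The outcome of the push-relabel algorithm: an overfull assignment `b` with labels `d`, and a
packing `P` that keeps half of each bin. -/
structure Certificate (b : Fin I.n → Option (Fin I.n)) (d : Fin I.n → ℕ)
    (P : Fin I.n → Option (Fin I.n)) : Prop where
  arc : ∀ u v, b u = some v → I.arc u v = true
  label : ∀ u v v', b u = some v → I.arc u v' = true → 3 * I.α u ≤ I.α v' → d v ≤ d v' + 1
  outside : ∀ u v', b u = none → I.arc u v' = true → 3 * I.α u ≤ I.α v' → I.n + 1 ≤ d v'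
  full : ∀ v, 0 < d v → I.α v ≤ I.seq (univ.filter fun u => b u = some v)
  kept : ∀ u v, P u = some v → b u = some v
  half : ∀ v, I.seq (univ.filter fun u => b u = some v) ≤
    2 * I.seq (univ.filter fun u => P u = some v)
  cap : ∀ v, I.seq (univ.filter fun u => P u = some v) ≤ I.α v

/-- The part of `P` that belongs to stage `i`. -/
def stage (P : Fin I.n → Option (Fin I.n)) (i : Fin 3) (u : Fin I.n) : Option (Fin I.n) :=
  if I.layer u = i then P u else none

variable {b P : Fin I.n → Option (Fin I.n)} {d : Fin I.n → ℕ}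

theorem stage_eq_some {i : Fin 3} {u v : Fin I.n} :
    stage P i u = some v ↔ I.layer u = i ∧ P u = some v := by
  unfold stage
  split_ifs with h <;> simp [h]

theorem profit_eq_sum (P : Fin I.n → Option (Fin I.n)) :
    profit P = ∑ v, I.seq (univ.filter fun u => P u = some v) := by
  rw [sum_seq_fiber, profit]
  congr 1
  ext u
  simp [Option.ne_none_iff_exists']

theorem Certificate.isPacking (h : Certificate b d P) (i : Fin 3) : IsPacking i (stage P i) := by
  refine ⟨fun u v hu => ?_, fun v => (seq_mono fun u hu => ?_).trans (h.cap v)⟩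
  · rw [stage_eq_some] at hu
    exact ⟨hu.1, h.arc u v (h.kept u v hu.2)⟩
  · rw [mem_filter, stage_eq_some] at hu
    exact mem_filter.mpr ⟨hu.1, hu.2.2⟩

/-- At most `I.n` labels meet `I.n + 1` candidates. -/
theorem exists_gap (d : Fin I.n → ℕ) : ∃ k, 1 ≤ k ∧ k ≤ I.n + 1 ∧ ∀ v, d v ≠ k := by
  have hcard : (univ.image d).card < (Icc 1 (I.n + 1)).card := by
    refine lt_of_le_of_lt card_image_le ?_
    simp
  obtain ⟨k, hk, hn⟩ := exists_mem_notMem_of_card_lt_card hcard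
  rw [mem_Icc] at hk
  exact ⟨k, hk.1, hk.2, fun v hv => hn (mem_image.mpr ⟨v, mem_univ v, hv⟩)⟩

/-- An arc into layer `i + 1` starts in layer `i`, so restricting to the stage removes nothing from
such a bin. -/
theorem Certificate.fiber_stage (h : Certificate b d P) (i : Fin 3) {v : Fin I.n}
    (hv : (I.layer v : ℕ) = i + 1) (Q : Fin I.n → Option (Fin I.n))
    (hQ : ∀ u w, Q u = some w → b u = some w) :
    (univ.filter fun u => stage Q i u = some v) = univ.filter fun u => Q u = some v := by
  ext u
  rw [mem_filter, mem_filter, stage_eq_some]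
  refine and_congr_right fun _ => ⟨fun h => h.2, fun hu => ⟨?_, hu⟩⟩
  have := I.arc_layer u v (h.arc u v (hQ u v hu))
  exact Fin.ext (by omega)

theorem Certificate.profit_le_overfull (h : Certificate b d P) (i : Fin 3)
    {Q : Fin I.n → Option (Fin I.n)} (hQ : IsPacking i Q) : profit Q ≤ profit (stage b i) := by
  obtain ⟨k, hk1, hkn, hk⟩ := exists_gap d
  obtain ⟨hQ1, hQ2⟩ := hQ
  have hfit : ∀ u v, Q u = some v → 3 * I.α u ≤ I.α v := fun u v hu =>
    (single_le_sum (f := fun u => 3 * I.α u) (fun _ _ => Nat.zero_le _)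
      (mem_filter.mpr ⟨mem_univ u, hu⟩)).trans (hQ2 v)
  -- `R` is the set of bins of the stage above the gap. `X` and `Y` are the items that `Q` and `b`
  -- put there, `Z` those that `b` puts elsewhere.
  let R : Finset (Fin I.n) := univ.filter fun v => k < d v ∧ (I.layer v : ℕ) = i + 1
  let X : Finset (Fin I.n) := univ.filter fun u => ∃ v ∈ R, Q u = some v
  let Y : Finset (Fin I.n) := univ.filter fun u => ∃ v ∈ R, stage b i u = some v
  let Z : Finset (Fin I.n) := univ.filter fun u => ∃ v, v ∉ R ∧ stage b i u = some v
  have hXY : I.seq X ≤ I.seq Y := by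
    rw [← sum_seq_fiber, ← sum_seq_fiber]
    refine sum_le_sum fun v hv => (hQ2 v).trans ?_
    rw [mem_filter] at hv
    rw [h.fiber_stage i hv.2.2 b (fun _ _ => id)]
    exact h.full v (by omega)
  have hsub : (univ.filter fun u => Q u ≠ none) ⊆ X ∪ Z := by
    intro u hu
    obtain ⟨v, hv⟩ := Option.ne_none_iff_exists'.mp (mem_filter.mp hu).2
    obtain ⟨hl, ha⟩ := hQ1 u v hv
    have hlv := I.arc_layer u v ha
    by_cases hR : v ∈ R
    · exact mem_union_left _ (mem_filter.mpr ⟨mem_univ _, v, hR, hv⟩)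
    · have hd : ¬ k < d v := fun hd => hR (mem_filter.mpr ⟨mem_univ _, hd, by rw [hlv, hl]⟩)
      have hdv : d v < k := lt_of_le_of_ne (not_lt.mp hd) (hk v)
      refine mem_union_right _ (mem_filter.mpr ⟨mem_univ _, ?_⟩)
      -- The label of `v` is below `k ≤ n + 1`, so `u` is not outside; its bin under `b` has label
      -- at most `d v + 1 ≤ k`, hence is not in `R`.
      cases hb : b u with
      | none =>
        have := h.outside u v hb ha (hfit u v hv)
        omega
      | some v' =>
        refine ⟨v', fun hR' => ?_, by rw [stage_eq_some]; exact ⟨hl, hb⟩⟩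
        have h1 := h.label u v' v hb ha (hfit u v hv)
        have h2 := (mem_filter.mp hR').2.1
        omega
  have hYZ : Disjoint Y Z := by
    rw [disjoint_filter]
    rintro u - ⟨v, hv, h1⟩ ⟨w, hw, h2⟩
    rw [h1] at h2
    obtain rfl := Option.some_injective _ h2
    exact hw hv
  calc profit Q ≤ I.seq (X ∪ Z) := seq_mono hsub
    _ ≤ I.seq X + I.seq Z := seq_union_le X Z
    _ ≤ I.seq Y + I.seq Z := Nat.add_le_add_right hXY _
    _ = I.seq (Y ∪ Z) := (seq_union hYZ).symm
    _ ≤ profit (stage b i) := seq_mono fun u hu => by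
      rw [mem_union, mem_filter, mem_filter] at hu
      rw [mem_filter]
      refine ⟨mem_univ _, Option.ne_none_iff_exists'.mpr ?_⟩
      rcases hu with ⟨-, v, -, hv⟩ | ⟨-, v, -, hv⟩ <;> exact ⟨v, hv⟩

theorem Certificate.isHalfApprox (h : Certificate b d P) (i : Fin 3) :
    IsHalfApprox i (stage P i) := by
  refine ⟨h.isPacking i, fun Q hQ => ?_⟩
  have h1 := h.profit_le_overfull i hQ
  have h2 : profit (stage b i) ≤ 2 * profit (stage P i) := by
    rw [profit_eq_sum, profit_eq_sum, mul_sum]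
    refine sum_le_sum fun v _ => ?_
    by_cases hv : (I.layer v : ℕ) = i + 1
    · rw [h.fiber_stage i hv b (fun _ _ => id), h.fiber_stage i hv P h.kept]
      exact h.half v
    · have : (univ.filter fun u => stage b i u = some v) = ∅ := by
        refine filter_eq_empty_iff.mpr fun u _ hu => hv ?_
        rw [stage_eq_some] at hu
        rw [I.arc_layer u v (h.arc u v hu.2), hu.1]
      simp [this, seq]
  have h3 : (profit Q : ℝ≥0) ≤ 2 * profit (stage P i) := by exact_mod_cast h1.trans h2
  rw [← NNReal.coe_le_coe] at h3 ⊢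
  push_cast at *
  linarith

/-! ### Merging the stages and comparing makespans -/

/-- Conflicts are resolved in favour of the later stage. -/
def merge (P : Fin I.n → Option (Fin I.n)) (u : Fin I.n) : Option (Fin I.n) :=
  match P u with
  | none => none
  | some v => if P v = none then some v else none

theorem merge_eq_some {u v : Fin I.n} : merge P u = some v ↔ P u = some v ∧ P v = none := by
  unfold merge
  cases h : P u with
  | none => simp
  | some w =>
    simp only [Option.ite_none_right_eq_some, Option.some.injEq]
    constructor
    · rintro ⟨h1, rfl⟩
      exact ⟨rfl, h1⟩
    · rintro ⟨rfl, h1⟩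
      exact ⟨h1, rfl⟩

/-- `P` is a packing for both stages at once. -/
structure IsMultiPacking (P : Fin I.n → Option (Fin I.n)) : Prop where
  arc : ∀ u v, P u = some v → I.arc u v = true
  cap : ∀ v, I.seq (univ.filter fun u => P u = some v) ≤ I.α v

theorem Certificate.isMultiPacking (h : Certificate b d P) : IsMultiPacking P :=
  ⟨fun u v hu => h.arc u v (h.kept u v hu), h.cap⟩

theorem IsMultiPacking.isForest_merge (h : IsMultiPacking P) : IsForest univ (merge P) where
  arc u v hu := h.arc u v (merge_eq_some.mp hu).1
  root u v hu := by simp [merge, (merge_eq_some.mp hu).2]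
  cap v := (seq_mono fun u hu => mem_filter.mpr
    ⟨mem_univ u, (merge_eq_some.mp (mem_filter.mp hu).2).1⟩).trans (h.cap v)
  mem _ v _ _ := mem_univ v

/-- Within one stage no bin is an item, so no conflict has to be resolved. -/
theorem IsPacking.isForest {i : Fin 3} {A : Finset (Fin I.n)} {Q : Fin I.n → Option (Fin I.n)}
    (hQ : IsPacking i Q) (hA : ∀ v, (I.layer v : ℕ) = i + 1 → v ∈ A) : IsForest A Q where
  arc u v hu := (hQ.1 u v hu).2
  root u v hu := by
    by_contra hne
    obtain ⟨w, hw⟩ := Option.ne_none_iff_exists'.mp hne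
    have h1 := hQ.1 u v hu
    have h2 := hQ.1 v w hw
    have h3 := I.arc_layer u v h1.2
    rw [h1.1, h2.1] at h3
    omega
  cap := hQ.2
  mem u v _ hu := hA v (by rw [I.arc_layer u v (hQ.1 u v hu).2, (hQ.1 u v hu).1])

theorem IsMultiPacking.stage_cases (h : IsMultiPacking P) {u v : Fin I.n} (hu : P u = some v) :
    I.layer u = 0 ∧ (I.layer v : ℕ) = 1 ∨ I.layer u = 1 ∧ P v = none := by
  have h1 := I.arc_layer u v (h.arc u v hu)
  have h2 := (I.layer v).isLt
  by_cases h0 : (I.layer u : ℕ) = 0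
  · exact .inl ⟨Fin.ext h0, by omega⟩
  · refine .inr ⟨Fin.ext (by simp; omega), ?_⟩
    by_contra hne
    obtain ⟨w, hw⟩ := Option.ne_none_iff_exists'.mp hne
    have h3 := I.arc_layer v w (h.arc v w hw)
    omega

/-- On `V₁` the conditions `P v = none` and `stage P 1 v = none` agree, and a host in `V₂` is never
packed, having no outgoing arc. -/
theorem IsMultiPacking.isMerge (h : IsMultiPacking P) {σ : I.Schedule}
    (hσ : ∀ u, σ u = time univ (merge P) u) : IsMerge (stage P 0) (stage P 1) σ := by
  have hF := h.isForest_merge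
  constructor
  · intro u v
    rw [hF.packedInto_iff hσ, merge_eq_some, stage_eq_some, stage_eq_some]
    constructor
    · rintro ⟨hu, hv⟩
      rcases h.stage_cases hu with h1 | h1
      · exact .inr ⟨⟨h1.1, hu⟩, by simp [stage, hv]⟩
      · exact .inl ⟨h1.1, hu⟩
    · rintro (⟨hl, hu⟩ | ⟨⟨hl, hu⟩, hv⟩)
      · rcases h.stage_cases hu with h1 | h1
        · rw [hl] at h1
          exact absurd h1.1 (by decide)
        · exact ⟨hu, h1.2⟩
      · rcases h.stage_cases hu with h1 | h1
        · refine ⟨hu, ?_⟩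
          rwa [stage, if_pos (Fin.ext h1.2)] at hv
        · exact ⟨hu, h1.2⟩
  · rw [hF.makespan_eq hσ]
    congr 2
    ext u
    simp only [mem_filter, mem_univ, true_and, hF.packedInto_iff hσ, not_exists]
    exact Option.eq_none_iff_forall_ne_some

/-- Merging loses only items whose bin `v` is packed by the second stage. Such a bin holds at most
`α v`, a third of the profit `3 * α v` that packing `v` earns. -/
theorem IsMultiPacking.seq_roots_le (h : IsMultiPacking P) :
    3 * I.seq (univ.filter fun u => merge P u = none) + 2 * profit (stage P 1) +
      3 * profit (stage P 0) ≤ 3 * I.seq univ := by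
  let L : Finset (Fin I.n) := univ.filter fun v => stage P 1 v ≠ none
  let Lost : Finset (Fin I.n) := univ.filter fun u => ∃ v ∈ L, P u = some v
  have hlost : 3 * I.seq Lost ≤ profit (stage P 1) := by
    rw [← sum_seq_fiber, profit, seq, ← mul_sum]
    exact Nat.mul_le_mul_left 3 (sum_le_sum fun v _ => h.cap v)
  have hsum : I.seq (univ.filter fun u => merge P u = none) +
      I.seq (univ.filter fun u => merge P u ≠ none) = I.seq univ :=
    sum_filter_add_sum_filter_not _ _ _
  have hpk : profit (stage P 1) + profit (stage P 0) ≤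
      I.seq (univ.filter fun u => merge P u ≠ none) + I.seq Lost := by
    rw [profit, profit, ← seq_union]
    · refine le_trans (seq_mono fun u hu => ?_) (seq_union_le _ _)
      have hne : P u ≠ none := by
        rw [mem_union, mem_filter, mem_filter] at hu
        rcases hu with hu | hu <;> exact fun h0 => hu.2 (by simp [stage, h0])
      obtain ⟨v, hv⟩ := Option.ne_none_iff_exists'.mp hne
      rw [mem_union, mem_filter, mem_filter]
      by_cases hPv : P v = none
      · left
        refine ⟨mem_univ _, ?_⟩
        rw [merge_eq_some.mpr ⟨hv, hPv⟩]
        simp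
      · right
        rcases h.stage_cases hv with h1 | h1
        · refine ⟨mem_univ _, v, mem_filter.mpr ⟨mem_univ _, ?_⟩, hv⟩
          rwa [stage, if_pos (Fin.ext h1.2)]
        · exact (hPv h1.2).elim
    · rw [disjoint_left]
      intro u hu hu'
      rw [mem_filter] at hu hu'
      by_cases h0 : I.layer u = 0
      · exact hu.2 (by simp [stage, h0])
      · exact hu'.2 (by simp [stage, h0])
  omega

/-- The merged schedule compared with an arbitrary schedule. -/
theorem makespan_merge_le (h : IsMultiPacking P) (h0 : IsHalfApprox 0 (stage P 0))
    (h1 : IsHalfApprox 1 (stage P 1)) {σ : I.Schedule}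
    (hσ : ∀ u, σ u = time univ (merge P) u) {τ : I.Schedule} (hτ : Feasible univ τ) :
    (makespan univ σ : ℝ) ≤ makespan univ τ + 2 / 3 * (I.seq (packed univ τ 1) : ℝ) +
      1 / 2 * (I.seq (packed univ τ 0) : ℝ) := by
  have hq0 := h0.2 _ (hτ.isPacking_stageHost 0)
  have hq1 := h1.2 _ (hτ.isPacking_stageHost 1)
  rw [profit_stageHost] at hq0 hq1
  have hu := hτ.seq_unpacked_le
  have hN := seq_eq_unpacked_add univ τ
  have hr := h.seq_roots_le
  rw [h.isForest_merge.makespan_eq hσ]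
  rw [← NNReal.coe_le_coe] at hq0 hq1 hu
  push_cast at hq0 hq1 hu
  have hN' : (I.seq univ : ℝ) = I.seq (unpacked univ τ) + I.seq (packed univ τ 0) +
    I.seq (packed univ τ 1) := by exact_mod_cast hN
  have hr' : 3 * (I.seq (univ.filter fun u => merge P u = none) : ℝ) +
    2 * (profit (stage P 1) : ℝ) + 3 * (profit (stage P 0) : ℝ) ≤ 3 * (I.seq univ : ℝ) := by
    exact_mod_cast hr
  rw [NNReal.coe_natCast]
  -- Half of the optimum is guaranteed in each stage, so `2/3` of the second profit recovers `1/3`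
  -- of the packed weight, leaving `2/3`; the first stage leaves `1/2`.
  linarith

/-- Optimal schedules of a stage pack at least as much as any packing. -/
theorem IsOptimal.profit_le {i : Fin 3} (hi : i ≠ 2) {A : Finset (Fin I.n)} {τ : I.Schedule}
    (hτ : IsOptimal A τ) (hA : ∀ v, v ∈ A ↔ (I.layer v : ℕ) = i ∨ (I.layer v : ℕ) = i + 1)
    {Q : Fin I.n → Option (Fin I.n)} (hQ : IsPacking i Q) : profit Q ≤ I.seq (packed A τ i) := by
  have hF := hQ.isForest (A := A) fun v hv => (hA v).mpr (.inr hv)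
  -- `Q` itself gives a feasible schedule of `A`, and optimality of `τ` bounds the unpacked work of
  -- `τ` by that of `Q`.
  have hle := hτ.2 (fun u => (time A Q u : ℝ≥0)) (hF.feasible fun _ => rfl)
  rw [hF.makespan_eq fun _ => rfl] at hle
  have hu : I.seq (unpacked A τ) ≤ I.seq (A.filter fun u => Q u = none) := by
    exact_mod_cast hτ.1.seq_unpacked_le.trans hle
  have hA' : I.seq A = I.seq (unpacked A τ) + I.seq (packed A τ i) := by
    have hN := seq_eq_unpacked_add A τ
    -- A packed task of another layer of `A` would need a host in layer `i + 2`, which is not in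
    -- `A`.
    have hempty : ∀ j : Fin 3, j ≠ i → packed A τ j = ∅ := by
      classical
      intro j hj
      unfold packed
      refine filter_eq_empty_iff.mpr ?_
      rintro u hu ⟨hl, v, hv, hp⟩
      have h1 := I.arc_layer u v hp.1
      rw [hA] at hu hv
      have : (j : ℕ) ≠ i := fun h => hj (Fin.ext h)
      rw [hl] at h1 hu
      omega
    have h0 : I.seq ∅ = 0 := by simp [seq]
    by_cases hi0 : i = 0
    · subst hi0
      rw [hempty 1 (by decide), h0] at hN
      omega
    · obtain rfl : i = 1 := by omega
      rw [hempty 0 (by decide), h0] at hN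
      omega
  have hQA : I.seq (A.filter fun u => Q u = none) + profit Q ≤ I.seq A := by
    rw [profit, ← seq_union]
    · refine seq_mono fun u hu => ?_
      rw [mem_union, mem_filter, mem_filter] at hu
      rcases hu with hu | hu
      · exact hu.1
      · obtain ⟨v, hv⟩ := Option.ne_none_iff_exists'.mp hu.2
        exact (hA u).mpr (.inl (by rw [(hQ.1 u v hv).1]))
    · rw [disjoint_left]
      intro u hu hu'
      exact (mem_filter.mp hu').2 (mem_filter.mp hu).2
  omega

end TwoStage

/-! ### Decoding the input and the result of the program -/

theorem List.getD_flatMap_of_length {β : Type*} (f : β → List ℕ) {n : ℕ}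
    (hf : ∀ x, (f x).length = n) (l : List β) (k v : ℕ) (hk : k < l.length) (hv : v < n) :
    (l.flatMap f).getD (k * n + v) 0 = (f l[k]).getD v 0 := by
  induction l generalizing k with
  | nil => simp at hk
  | cons x l ih =>
    rw [List.flatMap_cons]
    cases k with
    | zero =>
      rw [List.getD_append _ _ _ _ (by rw [hf]; omega)]
      simp
    | succ k =>
      have h : (k + 1) * n + v = n + (k * n + v) := by ring
      rw [List.getD_append_right _ _ _ _ (by rw [hf]; omega), hf, h, Nat.add_sub_cancel_left,
        ih k (by simpa using hk)]
      simp

theorem List.getD_ofFn {n : ℕ} (f : Fin n → ℕ) (u : Fin n) : (List.ofFn f).getD u 0 = f u := by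
  rw [List.getD_eq_getElem _ _ (by simp)]
  simp

namespace TwoStage

open RAM PushRelabel

variable (I : TwoStage)

theorem getD_encode_zero : I.encode.getD 0 0 = I.n := rfl

theorem le_length_encode : I.encode.getD 0 0 ≤ I.encode.length := by
  rw [getD_encode_zero]
  simp only [encode, List.length_append, List.length_cons, List.length_ofFn]
  omega

theorem getD_encode_α (u : Fin I.n) : I.encode.getD (I.n + (u + 1)) 0 = I.α u := by
  have hu := u.isLt
  rw [encode, List.getD_append _ _ _ _ (by simp),
    List.getD_append_right _ _ _ _ (by simp)]
  simp only [List.length_cons, List.length_ofFn]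
  rw [show I.n + ((u : ℕ) + 1) - (I.n + 1) = u by omega, List.getD_ofFn]

theorem getD_encode_arc (u v : Fin I.n) :
    I.encode.getD (I.n + (u + 1) * I.n + (v + 1)) 0 = (I.arc u v).toNat := by
  have h : I.n + ((u : ℕ) + 1) * I.n + (v + 1) = (I.n + 1 + I.n) + (u * I.n + v) := by ring
  have hlen : ((I.n :: List.ofFn fun u => (I.layer u : ℕ)) ++ List.ofFn I.α).length =
      I.n + 1 + I.n := by
    simp only [List.length_append, List.length_cons, List.length_ofFn]
  rw [h, encode, List.getD_append_right _ _ _ _ (by rw [hlen]; omega), hlen,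
    Nat.add_sub_cancel_left, List.getD_flatMap_of_length _ (by simp) _ _ _ (by simp) v.isLt,
    List.getD_ofFn]
  simp

/-- The task with number `x - 1`, nothing for `x = 0`. -/
def decode (n x : ℕ) : Option (Fin n) :=
  if h : 1 ≤ x ∧ x ≤ n then some ⟨x - 1, by omega⟩ else none

theorem decode_eq_some {n x : ℕ} {v : Fin n} : decode n x = some v ↔ x = v + 1 := by
  unfold decode
  have := v.isLt
  split_ifs with h
  · simp only [Option.some.injEq, Fin.ext_iff]
    omega
  · simp only [false_iff]
    omega

theorem decode_eq_none {n x : ℕ} (hx : x ≤ n) : decode n x = none ↔ x = 0 := by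
  unfold decode
  split_ifs with h
  · simp only [false_iff]
    omega
  · simp only [true_iff]
    omega

variable {I}

/-- The bound `k` turns the prefix loads of `startTime` into the index-ordered sums of `time`. -/
theorem binLoad_eq_seq {w : ℕ → ℕ} (hw : ∀ u : Fin I.n, w (u + 1) = 3 * I.α u) (f : ℕ → ℕ)
    (j : ℕ) {k : ℕ} (hk : k ≤ I.n) :
    binLoad k w f j = I.seq (univ.filter fun u : Fin I.n => f (u + 1) = j ∧ (u : ℕ) < k) := by
  rw [seq, sum_filter]
  have h1 : ∀ u : Fin I.n, (if f (u + 1) = j ∧ (u : ℕ) < k then 3 * I.α u else 0) =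
      (fun i => if f (i + 1) = j ∧ i < k then w (i + 1) else 0) u := fun u => by simp only [hw]
  rw [sum_congr rfl fun u _ => h1 u,
    Fin.sum_univ_eq_sum_range (fun i => if f (i + 1) = j ∧ i < k then w (i + 1) else 0) I.n,
    binLoad]
  refine sum_subset_zero_on_sdiff (by simpa using hk) (fun x hx => ?_) (fun x hx => ?_)
  · rw [mem_sdiff, mem_range, mem_range] at hx
    rw [if_neg (by tauto)]
  · rw [mem_range] at hx
    simp [hx]

theorem binLoad_succ_eq_seq {w : ℕ → ℕ} (hw : ∀ u : Fin I.n, w (u + 1) = 3 * I.α u)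
    (f : ℕ → ℕ) (v : Fin I.n) :
    binLoad I.n w f (v + 1) =
      I.seq (univ.filter fun u : Fin I.n => decode I.n (f (u + 1)) = some v) := by
  rw [binLoad_eq_seq hw f _ le_rfl]
  congr 1
  ext u
  simp [decode_eq_some]

/-- Both `{x}` and `S.erase x` respect the capacity, and the heavier of the two has at least half of
the weight. -/
theorem half_of_kept {S K : Finset (Fin I.n)} {c : ℕ} (hK : I.seq S ≤ c → K = S)
    (hS : c < I.seq S → ∃ x ∈ S, 3 * I.α x ≤ c ∧ I.seq S ≤ c + 3 * I.α x ∧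
      (6 * I.α x < I.seq S → K = S.erase x) ∧ (I.seq S ≤ 6 * I.α x → K = {x})) :
    I.seq S ≤ 2 * I.seq K ∧ I.seq K ≤ c := by
  rcases le_or_gt (I.seq S) c with h | h
  · rw [hK h]
    omega
  · obtain ⟨x, hx, h1, h2, h3, h4⟩ := hS h
    have h5 : 3 * I.α x + I.seq (S.erase x) = I.seq S := add_sum_erase S (fun u => 3 * I.α u) hx
    have h6 : I.seq {x} = 3 * I.α x := sum_singleton _ _
    rcases lt_or_ge (6 * I.α x) (I.seq S) with h | h
    · rw [h3 h]
      omega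
    · rw [h4 h]
      omega

/-- Tasks `0, …, n - 1` become items and bins `1, …, n`, which frees `0` to mean `none`. -/
theorem exists_certificate {s : ℕ → ℕ} (h : MainSpec I.n (fun i => I.encode.getD i 0) s) :
    ∃ b d P, Certificate (I := I) b d P ∧ ∀ u : Fin I.n, s u = time univ (merge P) u := by
  classical
  obtain ⟨R, al, b, d, e, pk, p, hR, hal, hI, he, hna, ⟨hpk0, hpk⟩, hp, hs⟩ := h
  have hα : ∀ u : Fin I.n, al (u + 1) = I.α u := fun u => by
    rw [hal _ (by omega) (by omega)]
    exact I.getD_encode_α u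
  have hw : ∀ u : Fin I.n, wt al (u + 1) = 3 * I.α u := fun u => by
    unfold wt
    rw [hα]
    omega
  have hfit : ∀ u v : Fin I.n, Fits (fun i => I.encode.getD i 0) R al (u + 1) (v + 1) ↔
      I.arc u v = true ∧ 3 * I.α u ≤ I.α v := by
    intro u v
    unfold Fits
    rw [hR _ (by omega) (by omega), hw, hα]
    beta_reduce
    rw [I.getD_encode_arc]
    cases I.arc u v <;> simp
    omega
  have hpkle : ∀ x, 1 ≤ x → x ≤ I.n → pk x ≤ I.n := fun x x1 hx => by
    rw [hpk x x1 hx]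
    split_ifs
    exacts [hI.bin_le x, Nat.zero_le _]
  have hload := binLoad_succ_eq_seq hw b
  have hhalf : ∀ v : Fin I.n,
      I.seq (univ.filter fun u : Fin I.n => decode I.n (b (u + 1)) = some v) ≤
        2 * I.seq (univ.filter fun u : Fin I.n => decode I.n (pk (u + 1)) = some v) ∧
      I.seq (univ.filter fun u : Fin I.n => decode I.n (pk (u + 1)) = some v) ≤ I.α v := by
    intro v
    have hmem : ∀ u : Fin I.n, decode I.n (pk (u + 1)) = some v ↔ b (u + 1) = v + 1 ∧
        Kept al b (binLoad I.n (wt al) b) e (u + 1) := by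
      intro u
      rw [decode_eq_some, hpk _ (by omega) (by omega)]
      split_ifs with hk <;> simp [hk]
    apply half_of_kept
    · intro hle
      ext u
      rw [mem_filter, mem_filter, hmem, decode_eq_some]
      refine and_congr_right fun _ => ⟨fun h => h.1, fun h => ⟨h, .inl ?_⟩⟩
      rw [h, hload, hα]
      exact hle
    · intro hlt
      -- An overfull bin is nonempty, so if no extra item were recorded, its items would be active,
      -- which is excluded at termination.
      rcases he (v + 1) (by omega) (by omega) with ⟨-, h2⟩ | ⟨h1, h2, h3, h4⟩
      · exfalso
        obtain ⟨u, hu⟩ : (univ.filter fun u : Fin I.n =>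
            decode I.n (b (u + 1)) = some v).Nonempty := by
          rw [nonempty_iff_ne_empty]
          intro h0
          simp [h0, seq] at hlt
        rw [mem_filter, decode_eq_some] at hu
        exact hna (u + 1) (by omega) (by omega) ⟨by omega, fun i i1 hi hb => by
          rw [hu.2] at hb ⊢
          exact h2 i i1 hi hb⟩
      · obtain ⟨x, hx⟩ : ∃ x : Fin I.n, (x : ℕ) + 1 = e (v + 1) :=
          ⟨⟨e (v + 1) - 1, by omega⟩, by simp; omega⟩
        rw [← hx] at h3 h4
        have hel := hI.el_bin (x + 1) (by omega) (by omega) (by omega)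
        rw [h3, hfit] at hel
        rw [hload, hα, hw] at h4
        have hkept : ∀ u : Fin I.n, b (u + 1) = v + 1 →
            (Kept al b (binLoad I.n (wt al) b) e (u + 1) ↔
              (u ≠ x ∧ 6 * I.α x <
                I.seq (univ.filter fun u : Fin I.n => decode I.n (b (u + 1)) = some v)) ∨
              (u = x ∧ I.seq (univ.filter fun u : Fin I.n =>
                decode I.n (b (u + 1)) = some v) ≤ 6 * I.α x)) := by
          intro u hu
          unfold Kept
          rw [hu, hload, hα, ← hx, hw]
          simp only [ne_eq, Fin.ext_iff]
          omega
        refine ⟨x, mem_filter.mpr ⟨mem_univ _, decode_eq_some.mpr h3⟩, hel.2, h4,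
          fun hc => ?_, fun hc => ?_⟩
        · ext u
          rw [mem_filter, mem_erase, mem_filter, hmem, decode_eq_some]
          constructor
          · rintro ⟨-, hb, hk⟩
            rw [hkept u hb] at hk
            rcases hk with hk | hk
            · exact ⟨hk.1, mem_univ _, hb⟩
            · omega
          · rintro ⟨hne, -, hb⟩
            exact ⟨mem_univ _, hb, (hkept u hb).mpr (.inl ⟨hne, hc⟩)⟩
        · ext u
          rw [mem_filter, mem_singleton, hmem]
          constructor
          · rintro ⟨-, hb, hk⟩
            rw [hkept u hb] at hk
            rcases hk with hk | hk
            · omega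
            · exact hk.1
          · rintro rfl
            exact ⟨mem_univ _, h3, (hkept _ h3).mpr (.inr ⟨rfl, hc⟩)⟩
  refine ⟨fun u => decode I.n (b (u + 1)), fun v => d (v + 1), fun u => decode I.n (pk (u + 1)),
    ⟨fun u v hu => ?_, fun u v v' hu ha hf => ?_, fun u v' hu ha hf => ?_, fun v hv => ?_,
      fun u v hu => ?_, fun v => (hhalf v).1, fun v => (hhalf v).2⟩, fun u => ?_⟩
  · rw [decode_eq_some] at hu
    have := hI.el_bin (u + 1) (by omega) (by omega) (by omega)
    rw [hu, hfit] at this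
    exact this.1
  · rw [decode_eq_some] at hu
    have := hI.label (u + 1) (v' + 1) (by omega) (by omega) (by omega) (by omega) (by omega)
      ((hfit u v').mpr ⟨ha, hf⟩)
    rwa [hu] at this
  · rw [decode_eq_none (hI.bin_le _)] at hu
    exact hI.outside (u + 1) (v' + 1) (by omega) (by omega) (by omega) (by omega) hu
      ((hfit u v').mpr ⟨ha, hf⟩)
  · rw [← hload, ← hα]
    exact hI.full (v + 1) (by omega) (by omega) hv
  · rw [decode_eq_some] at hu ⊢
    rw [hpk _ (by omega) (by omega)] at hu
    split_ifs at hu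
    exact hu
  · have hple : ∀ x, 1 ≤ x → x ≤ I.n → p x ≤ I.n := fun x x1 hx => by
      rw [hp x x1 hx]
      split_ifs
      exacts [hpkle x x1 hx, Nat.zero_le _]
    have hmerge : ∀ u : Fin I.n,
        merge (fun u : Fin I.n => decode I.n (pk (u + 1))) u = decode I.n (p (u + 1)) := by
      intro u
      apply Option.ext
      intro v
      rw [merge_eq_some, decode_eq_some, decode_eq_some,
        decode_eq_none (hpkle _ (by omega) (by omega)), hp _ (by omega) (by omega)]
      constructor
      · rintro ⟨h1, h2⟩
        rw [h1, if_pos h2]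
      · intro h
        split_ifs at h with h0
        exact ⟨h, by rwa [h] at h0⟩
    have hroot : ∀ v : Fin I.n, binLoad v (wt al) p 0 =
        rootTime univ (merge (fun u : Fin I.n => decode I.n (pk (u + 1)))) v := by
      intro v
      rw [binLoad_eq_seq hw p 0 v.isLt.le, rootTime]
      congr 1
      ext x
      rw [mem_filter, mem_filter, hmerge, decode_eq_none (hple _ (by omega) (by omega)),
        Fin.lt_def]
    rw [hs u u.isLt, startTime]
    split_ifs with h0
    · rw [time_root (by rw [hmerge, decode_eq_none (hple _ (by omega) (by omega))]; exact h0),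
        ← hroot, Nat.add_sub_cancel]
    · obtain ⟨v, hv⟩ : ∃ v : Fin I.n, p (u + 1) = v + 1 :=
        ⟨⟨p (u + 1) - 1, by have := hple (u + 1) (by omega) (by omega); omega⟩, by simp; omega⟩
      rw [time_leaf (by rw [hmerge, decode_eq_some]; exact hv), ← hroot, hv, Nat.add_sub_cancel,
        Nat.add_sub_cancel, hα, binLoad_eq_seq hw p _ u.isLt.le]
      congr 2
      ext x
      rw [mem_filter, mem_filter, hmerge, decode_eq_some, Fin.lt_def]

end TwoStage

/-! ### The algorithm and its guarantees -/

/-- There is a program that computes, in polynomial time, the schedule of the merge of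
half-approximate packings. -/
theorem exists_algorithm : ∃ A : (I : TwoStage) → Fin I.n → ℕ,
    RAM.PolyTimeComputable TwoStage.encode (fun I => List.ofFn (A I)) ∧
    ∀ I : TwoStage, ∃ b d P, TwoStage.Certificate (I := I) b d P ∧
      ∀ u, A I u = TwoStage.time univ (TwoStage.merge P) u := by
  obtain ⟨q, hq⟩ := RAM.exists_exec_mainProg
  choose m t hex ht h1 hspec using fun I : TwoStage => hq I.encode I.le_length_encode
  refine ⟨fun I u => m I 0 u, ⟨RAM.mainProg, q, fun I => ⟨m I, t I, hex I, ⟨?_, ?_⟩, ht I⟩⟩,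
    fun I => ?_⟩
  · rw [h1, List.length_ofFn, TwoStage.getD_encode_zero]
  · intro i hi
    rw [List.length_ofFn] at hi
    exact (List.getD_ofFn (fun u : Fin I.n => m I 0 u) ⟨i, hi⟩).symm
  · exact TwoStage.exists_certificate (hspec I)

theorem theorem4p4 :
    ∃ A : (I : TwoStage) → Fin I.n → ℕ,
      RAM.PolyTimeComputable TwoStage.encode (fun I => List.ofFn (A I)) ∧
      ∀ (I : TwoStage) (σ : I.Schedule), (∀ u, σ u = (A I u : ℝ≥0)) →
        TwoStage.Feasible univ σ ∧
        -- the schedule is the merge of half-approximate packings of the two stages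
        (∃ P₀ P₁ : Fin I.n → Option (Fin I.n),
          TwoStage.IsHalfApprox 0 P₀ ∧ TwoStage.IsHalfApprox 1 P₁ ∧
          TwoStage.IsMerge P₀ P₁ σ) ∧
        -- approximation factor
        (∀ τ : I.Schedule, TwoStage.Feasible univ τ →
          TwoStage.makespan univ σ ≤ 13 / 9 * TwoStage.makespan univ τ) ∧
        -- additive bound, in terms of the tasks packed in the schedule compared with
        (∀ τ : I.Schedule, TwoStage.Feasible univ τ →
          TwoStage.makespan univ σ ≤ TwoStage.makespan univ τ
            + 5 / 6 * (I.seq (TwoStage.packed univ τ 1) : ℝ≥0)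
            + 1 / 2 * (I.seq (TwoStage.packed univ τ 0) : ℝ≥0)) ∧
        -- additive bound, in terms of the tasks packed in optimal schedules of the two stages
        (∀ τ τ₀ τ₁ : I.Schedule, TwoStage.Feasible univ τ →
          TwoStage.IsOptimal (I.V 0 ∪ I.V 1) τ₀ → TwoStage.IsOptimal (I.V 1 ∪ I.V 2) τ₁ →
          TwoStage.makespan univ σ ≤ TwoStage.makespan univ τ
            + 5 / 6 * (I.seq (TwoStage.packed (I.V 1 ∪ I.V 2) τ₁ 1) : ℝ≥0)
            + 1 / 2 * (I.seq (TwoStage.packed (I.V 0 ∪ I.V 1) τ₀ 0) : ℝ≥0)) := by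
  obtain ⟨A, hA, hcert⟩ := exists_algorithm
  refine ⟨A, hA, fun I σ hσA => ?_⟩
  obtain ⟨b, d, P, hc, hs⟩ := hcert I
  have hσ : ∀ u, σ u = TwoStage.time univ (TwoStage.merge P) u := fun u => by rw [hσA, hs]
  have hP := hc.isMultiPacking
  have main := fun τ (hτ : TwoStage.Feasible univ τ) =>
    TwoStage.makespan_merge_le hP (hc.isHalfApprox 0) (hc.isHalfApprox 1) hσ hτ
  refine ⟨hP.isForest_merge.feasible hσ, ⟨_, _, hc.isHalfApprox 0, hc.isHalfApprox 1,
    hP.isMerge hσ⟩, fun τ hτ => ?_, fun τ hτ => ?_, fun τ τ₀ τ₁ hτ h0 h1 => ?_⟩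
  -- The excess `2/3 p₁ + 1/2 p₀` is at most `2/3 (p₀ + p₁)`, hence at most `2/9` of the makespan of
  -- `τ`; this even gives the factor `11/9`.
  · have h := main τ hτ
    have h3 := hτ.seq_packed_le
    have h4 : (0 : ℝ) ≤ I.seq (TwoStage.packed univ τ 0) := Nat.cast_nonneg _
    have h5 : (0 : ℝ) ≤ I.seq (TwoStage.packed univ τ 1) := Nat.cast_nonneg _
    rw [← NNReal.coe_le_coe] at h3 ⊢
    push_cast at *
    linarith
  · have h := main τ hτ
    have h5 : (0 : ℝ) ≤ I.seq (TwoStage.packed univ τ 1) := Nat.cast_nonneg _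
    rw [← NNReal.coe_le_coe]
    push_cast
    linarith
  · have h := main τ hτ
    -- The tasks that `τ` packs in a stage form a packing of it, so an optimal schedule of that
    -- stage alone packs at least as much.
    have k0 := h0.profit_le (i := 0) (by decide) (fun v => by
      simp only [TwoStage.V, mem_union, mem_filter, mem_univ, true_and, Fin.ext_iff]; rfl)
      (hτ.isPacking_stageHost 0)
    have k1 := h1.profit_le (i := 1) (by decide) (fun v => by
      simp only [TwoStage.V, mem_union, mem_filter, mem_univ, true_and, Fin.ext_iff]; rfl)
      (hτ.isPacking_stageHost 1)
    rw [TwoStage.profit_stageHost] at k0 k1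
    have k0' : (I.seq (TwoStage.packed univ τ 0) : ℝ) ≤
      I.seq (TwoStage.packed (I.V 0 ∪ I.V 1) τ₀ 0) := by exact_mod_cast k0
    have k1' : (I.seq (TwoStage.packed univ τ 1) : ℝ) ≤
      I.seq (TwoStage.packed (I.V 1 ∪ I.V 2) τ₁ 1) := by exact_mod_cast k1
    have h5 : (0 : ℝ) ≤ I.seq (TwoStage.packed univ τ 1) := Nat.cast_nonneg _
    rw [← NNReal.coe_le_coe]
    push_cast
    linarith
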